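/- **Setting.** A *lattice* is a function of $s\in\mathbb C$ of the form $x(s)=c_1q^{-s}+c_2q^{s}+c_3$ with $q\in\mathbb C\setminus\{0,1\}$, $c_1\ne 0$, or $x(s)=c_4s^2+c_5s+c_6$ with $c_4\neq 0$. The divided-difference operator $\mathbb D_x$ maps a polynomial $f$ to the polynomial $\mathbb D_xf$ determined by $$\mathbb D_xf(x(s))=\frac{f(x(s+\frac12))-f(x(s-\frac12))}{x(s+\frac12)-x(s-\frac12)} .$$ A sequence of polynomials $(P_n)_{n\ge 0}$ is *orthogonal with respect to a weight $w$ on $(a,b)$*, $-\infty\le a<b\le\infty$, if all moments $\int_a^b t^kw(t)\,dt$ exist, $\int_a^bP_mP_nw\,dt=0$ for $m\ne n$ and $\int_a^bP_n^2w\,dt\neq0$ for all $n$. We say that $(P_n)_{n\ge0}$ satisfies the *second structure relation* on the lattice $x$ if there are constants $b_{n,n+j}$, $-2\le j\le 2$, such that $$P_n=\sum_{j=-2}^{2}b_{n,n+j}\,\mathbb D_x^2P_{n+j},\qquad b_{n,n+2}\ne0,\qquad n=2,3,\dots.$$ **Proposition.** Let $\deg P_n=n$ and let $(P_n)_{n\ge0}$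 be orthogonal with respect to a weight function $W$ on $(a,b)$. If $(\mathbb D_x^2P_n)_{n\ge2}$ is orthogonal with respect to $\pi W$ on $(a,b)$ for some polynomial $\pi$ of degree at most $4$, then $(P_n)$ satisfies the second structure relation on the lattice $x$. **Corollary.** Write $(a;q)_k=\prod_{j<k}(1-aq^j)$ and $(a)_k=\prod_{j<k}(a+j)$. 1. Let $q\in\mathbb C\setminus\{0\}$ be not a root of unity, $c_1c_2\neq0$, $\kappa^2=4c_1c_2$, and let $x(s)=c_1q^{-s}+c_2q^s+c_3$. Then $P_n\big(\frac{x-c_3}{\kappa}\big)$ satisfies the second structure relation on this lattice whenever $(P_n)$ is one of the following families (for $c_1=c_2=\frac12$, $c_3=0$, $\kappa=1$ this is $P_n(x)$ itself, with $x=\cos\theta$, $q^s=e^{i\theta}$): - the Askey–Wilson polynomials $$p_n(\cos\theta;a,b,c,d\,|\,q)=\frac{(ab,ac,ad;q)_n}{a^n}\;{}_4\phi_3\left(\begin{matrix}q^{-n},abcdq^{n-1},ae^{-i\theta},ae^{i\theta}\\ab,ac,ad\end{matrix};q,q\right),$$ with $a,b,c,d\in\mathbb C$, $a\neq0$, $abcd\,q^m\ne1$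 for $m=0,1,2,\dots$ (where $(ab;q)_n/(ab;q)_k$ means $(abq^k;q)_{n-k}$, and likewise for $ac$ and $ad$); - the continuous $q$-Hermite polynomials $H_n(\cos\theta\,|\,q)=\sum_{k=0}^n\frac{(q;q)_n}{(q;q)_k(q;q)_{n-k}}e^{i(n-2k)\theta}$ (the special case $a=b=c=d=0$); - every limiting case of the Askey–Wilson polynomials: every sequence $(Q_n)$ with $\deg Q_n=n$ such that each $Q_n$ is the coefficientwise limit of suitable constant multiples of $p_n(\,\cdot\,;a_i,b_i,c_i,d_i\,|\,q)$ as $i\to\infty$, where the parameters are admissible as above and each of the sequences $(a_i),(b_i),(c_i),(d_i)$ either converges in $\mathbb C$ or tends to $\infty$. 2. Let $x(s)=c_4s^2+c_5s+c_6$, $c_4\ne0$. Then $P_n\big(-\frac{x-c_6}{c_4}-\frac{c_5^2}{4c_4^2}\big)$, that is $P_n\big(-(s+\frac{c_5}{2c_4})^2\big)$, satisfies the second structure relation on this lattice whenever $(P_n)$ is one of the following families (for $c_4=-1$, $c_5=c_6=0$ this is $P_n(x)$ itself, with $x=t^2$, $t=is$): - the Wilson polynomials $$W_n(t^2;a,b,c,d)=(a+b)_n(a+c)_n(a+d)_n\;{}_4F_3\left(\begin{matrix}-n,n+a+b+c+d-1,a-it,a+it\\a+b,a+c,a+d\end{matrix};1\right),$$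 with $a,b,c,d\in\mathbb C$, $a+b+c+d+m\neq0$ for $m=0,1,2,\dots$; - the continuous dual Hahn polynomials $$S_n(t^2;a,b,c)=(a+b)_n(a+c)_n\;{}_3F_2\left(\begin{matrix}-n,a-it,a+it\\a+b,a+c\end{matrix};1\right),\qquad a,b,c\in\mathbb C$$ (in both, $(a+b)_n/(a+b)_k$ means $(a+b+k)_{n-k}$, and likewise for the other denominator parameters); - every limiting case, in the same sense as in 1, of the (admissible) Wilson polynomials or of the continuous dual Hahn polynomials. -/

import Mathlib

open Polynomial Filter Topology MeasureTheory

noncomputable section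

namespace StructureRelation

/-- The `q`-quadratic lattices `x(s) = c₁ q^(-s) + c₂ q^s + c₃` (`q ≠ 1`, `c₁ ≠ 0`) and the
quadratic lattices `x(s) = c₄ s² + c₅ s + c₆` (`c₄ ≠ 0`, the case `q = 1`). -/
inductive Lattice where
  | qQuadratic (q c₁ c₂ c₃ : ℂ) (hq₀ : q ≠ 0) (hq₁ : q ≠ 1) (hc₁ : c₁ ≠ 0) : Lattice
  | quadratic (c₄ c₅ c₆ : ℂ) (hc₄ : c₄ ≠ 0) : Lattice

namespace Lattice

/-- The lattice function `s ↦ x(s)`; powers of `q` use the principal branch. -/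
def x : Lattice → ℂ → ℂ
  | qQuadratic q c₁ c₂ c₃ _ _ _, s => c₁ * q ^ (-s) + c₂ * q ^ s + c₃
  | quadratic c₄ c₅ c₆ _, s => c₄ * s ^ 2 + c₅ * s + c₆

/-- `g` is the divided difference of `f` along the lattice:
`g(x(s)) = (f(x(s+1/2)) - f(x(s-1/2))) / (x(s+1/2) - x(s-1/2))`, with the denominator cleared. -/
def IsDividedDifference (L : Lattice) (f g : ℂ[X]) : Prop :=
  ∀ s : ℂ, g.eval (L.x s) * (L.x (s + 1 / 2) - L.x (s - 1 / 2)) =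
    f.eval (L.x (s + 1 / 2)) - f.eval (L.x (s - 1 / 2))

/-- The sum `x(s+1/2) + x(s-1/2)` and the square of `x(s+1/2) - x(s-1/2)` are polynomials in
`x(s)`, the second one a nonzero polynomial. -/
theorem exists_sum_sq (L : Lattice) : ∃ A B : ℂ[X], B ≠ 0 ∧ ∀ s : ℂ,
    L.x (s + 1 / 2) + L.x (s - 1 / 2) = A.eval (L.x s) ∧
    (L.x (s + 1 / 2) - L.x (s - 1 / 2)) ^ 2 = B.eval (L.x s) := by
  cases L with
  | qQuadratic q c₁ c₂ c₃ hq₀ hq₁ hc₁ =>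
    obtain ⟨p, hp⟩ : ∃ p : ℂ, p = q ^ (1 / 2 : ℂ) := ⟨_, rfl⟩
    have hp0 : p ≠ 0 := by
      rw [hp]; exact (Complex.cpow_ne_zero_iff_of_exponent_ne_zero (by norm_num)).2 hq₀
    have hpp : p * p = q := by
      rw [hp, ← Complex.cpow_add _ _ hq₀]; norm_num
    have hne : p - p⁻¹ ≠ 0 := by
      intro h
      apply hq₁
      rw [← hpp]
      have : p * (p - p⁻¹) = 0 := by rw [h, mul_zero]
      rw [mul_sub, mul_inv_cancel₀ hp0] at this
      exact sub_eq_zero.1 this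
    refine ⟨C (p + p⁻¹) * (X - C c₃) + C (2 * c₃),
      C ((p - p⁻¹) ^ 2) * ((X - C c₃) ^ 2 - C (4 * c₁ * c₂)), ?_, ?_⟩
    · refine mul_ne_zero (C_ne_zero.2 (pow_ne_zero 2 hne)) ?_
      intro h
      have h2 := congrArg (fun f : ℂ[X] => f.eval (c₃ + 1) + f.eval (c₃ - 1) - 2 * f.eval c₃) h
      simp only [eval_sub, eval_pow, eval_X, eval_C, eval_zero] at h2
      have h3 : (2 : ℂ) = 0 := by linear_combination h2
      norm_num at h3
    · intro s
      have e1 : q ^ (s + 1 / 2) = q ^ s * p := by rw [hp, Complex.cpow_add _ _ hq₀]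
      have e2 : q ^ (s - 1 / 2) = q ^ s * p⁻¹ := by
        rw [hp, Complex.cpow_sub _ _ hq₀, div_eq_mul_inv]
      have hz : q ^ s ≠ 0 := by simp [Complex.cpow_eq_zero_iff, hq₀]
      simp only [x, Complex.cpow_neg, e1, e2]
      constructor
      · simp only [eval_add, eval_mul, eval_sub, eval_C, eval_X]
        field_simp
        ring
      · simp only [eval_mul, eval_sub, eval_C, eval_X, eval_pow]
        field_simp
        ring
  | quadratic c₄ c₅ c₆ hc₄ =>
    refine ⟨C 2 * X + C (c₄ / 2), C (4 * c₄) * X + C (c₅ ^ 2 - 4 * c₄ * c₆), ?_, ?_⟩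
    · intro h
      have h2 := congrArg (fun f : ℂ[X] => f.eval 1 - f.eval 0) h
      simp [hc₄] at h2
    · intro s
      simp only [x, eval_add, eval_mul, eval_C, eval_X]
      constructor <;> ring

theorem x_range_infinite (L : Lattice) : (Set.range L.x).Infinite := by
  cases L with
  | qQuadratic q c₁ c₂ c₃ hq₀ hq₁ hc₁ =>
    have hl : Complex.log q ≠ 0 := by
      intro h
      apply hq₁
      rw [← Complex.exp_log hq₀, h, Complex.exp_zero]
    refine Set.Infinite.mono (s := {c₃}ᶜ) ?_ (Set.Finite.infinite_compl (Set.finite_singleton c₃))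
    intro v hv
    have hv' : c₃ - v ≠ 0 := by
      intro h; exact hv (by simp [sub_eq_zero.1 h])
    obtain ⟨z, hz⟩ : ∃ z : ℂ, c₂ * z ^ 2 + (c₃ - v) * z + c₁ = 0 := by
      by_cases h2 : c₂ = 0
      · refine ⟨-c₁ / (c₃ - v), ?_⟩
        rw [h2]; field_simp; ring
      · have hd : (C c₂ * X ^ 2 + C (c₃ - v) * X + C c₁ : ℂ[X]).degree ≠ 0 := by
          rw [degree_quadratic h2]; norm_num
        obtain ⟨z, hz⟩ := IsAlgClosed.exists_root _ hd
        exact ⟨z, by simpa [IsRoot] using hz⟩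
    have hz0 : z ≠ 0 := by
      rintro rfl
      apply hc₁
      simpa using hz
    refine ⟨Complex.log z / Complex.log q, ?_⟩
    have e : q ^ (Complex.log z / Complex.log q) = z := by
      rw [Complex.cpow_def_of_ne_zero hq₀, mul_div_cancel₀ _ hl, Complex.exp_log hz0]
    simp only [x, Complex.cpow_neg, e]
    field_simp
    linear_combination hz
  | quadratic c₄ c₅ c₆ hc₄ =>
    refine Set.Infinite.mono (s := Set.univ) ?_ Set.infinite_univ
    intro v _
    have hd : (C c₄ * X ^ 2 + C c₅ * X + C (c₆ - v) : ℂ[X]).degree ≠ 0 := by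
      rw [degree_quadratic hc₄]; norm_num
    obtain ⟨z, hz⟩ := IsAlgClosed.exists_root _ hd
    have hz' : c₄ * z ^ 2 + c₅ * z + (c₆ - v) = 0 := by simpa [IsRoot] using hz
    exact ⟨z, by simp only [x]; linear_combination hz'⟩

theorem existsUnique_dividedDifference (L : Lattice) (f : ℂ[X]) :
    ∃! g : ℂ[X], L.IsDividedDifference f g := by
  obtain ⟨A, B, hB, hAB⟩ := L.exists_sum_sq
  have hex : ∃ g h : ℂ[X], L.IsDividedDifference f g ∧ ∀ s : ℂ,
      2 * h.eval (L.x s) = f.eval (L.x (s + 1 / 2)) + f.eval (L.x (s - 1 / 2)) := by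
    induction f using Polynomial.induction_on with
    | C a => exact ⟨0, C a, fun s => by simp, fun s => by simp; ring⟩
    | add p r hp hr =>
      obtain ⟨g₁, h₁, hg₁, hh₁⟩ := hp
      obtain ⟨g₂, h₂, hg₂, hh₂⟩ := hr
      refine ⟨g₁ + g₂, h₁ + h₂, fun s => ?_, fun s => ?_⟩
      · have h1 := hg₁ s
        have h2 := hg₂ s
        simp only [eval_add]
        linear_combination h1 + h2
      · have h1 := hh₁ s
        have h2 := hh₂ s
        simp only [eval_add]
        linear_combination h1 + h2
    | monomial n a ih =>
      obtain ⟨g, h, hg, hh⟩ := ih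
      refine ⟨C (1 / 2) * A * g + h, C (1 / 2) * A * h + C (1 / 4) * B * g,
        fun s => ?_, fun s => ?_⟩
      · have h1 := hg s
        have h2 := hh s
        obtain ⟨h3, h4⟩ := hAB s
        simp only [eval_add, eval_mul, eval_C, eval_pow, eval_X, pow_succ] at h1 h2 ⊢
        rw [← h3]
        linear_combination (1 / 2) * (L.x (s + 1 / 2) + L.x (s - 1 / 2)) * h1 +
          (1 / 2) * (L.x (s + 1 / 2) - L.x (s - 1 / 2)) * h2
      · have h1 := hg s
        have h2 := hh s
        obtain ⟨h3, h4⟩ := hAB s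
        simp only [eval_add, eval_mul, eval_C, eval_pow, eval_X, pow_succ] at h1 h2 ⊢
        rw [← h3, ← h4]
        linear_combination (1 / 2) * (L.x (s + 1 / 2) + L.x (s - 1 / 2)) * h2 +
          (1 / 2) * (L.x (s + 1 / 2) - L.x (s - 1 / 2)) * h1
  obtain ⟨g, h, hg, -⟩ := hex
  refine ⟨g, hg, fun g' hg' => ?_⟩
  have key : (g' - g) * B = 0 := by
    apply Polynomial.eq_zero_of_infinite_isRoot
    refine L.x_range_infinite.mono ?_
    rintro _ ⟨s, rfl⟩
    have h1 := hg s
    have h2 := hg' s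
    have h4 := (hAB s).2
    simp only [Set.mem_ofPred_eq, IsRoot, eval_mul, eval_sub]
    rw [← h4]
    linear_combination (L.x (s + 1 / 2) - L.x (s - 1 / 2)) * (h2 - h1)
  rcases mul_eq_zero.1 key with h0 | h0
  · exact sub_eq_zero.1 h0
  · exact absurd h0 hB

/-- The divided-difference operator `𝔻ₓ` on polynomials: `𝔻ₓ f` is the unique polynomial with
`(𝔻ₓ f)(x(s)) = (f(x(s+1/2)) - f(x(s-1/2))) / (x(s+1/2) - x(s-1/2))`. -/
def D (L : Lattice) (f : ℂ[X]) : ℂ[X] := (L.existsUnique_dividedDifference f).choose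

theorem D_spec (L : Lattice) (f : ℂ[X]) : L.IsDividedDifference f (L.D f) :=
  (L.existsUnique_dividedDifference f).choose_spec.1

end Lattice

/-- `(Pₙ)` is orthogonal on the (possibly unbounded) interval `(a, b)` with respect to the weight
function `w`: all moments exist, `∫ Pₘ Pₙ w = 0` for `m ≠ n`, and `∫ Pₙ² w ≠ 0`.
No sign is imposed on `w`; for a positive weight and real polynomials this is the usual notion. -/
structure IsOrthogonal (a b : EReal) (w : ℝ → ℂ) (P : ℕ → ℂ[X]) : Prop where
  integrable : ∀ k : ℕ,
    IntegrableOn (fun t : ℝ => (t : ℂ) ^ k * w t) {t : ℝ | a < (t : EReal) ∧ (t : EReal) < b}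
  orthogonal : ∀ m n : ℕ, m ≠ n →
    ∫ t in {t : ℝ | a < (t : EReal) ∧ (t : EReal) < b},
      (P m).eval (t : ℂ) * (P n).eval (t : ℂ) * w t = 0
  norm_ne_zero : ∀ n : ℕ,
    ∫ t in {t : ℝ | a < (t : EReal) ∧ (t : EReal) < b}, (P n).eval (t : ℂ) ^ 2 * w t ≠ 0

/-- The second structure relation `Pₙ = ∑_{j=-2}^{2} b_{n,n+j} 𝔻ₓ² P_{n+j}` with
`b_{n,n+2} ≠ 0`, for `n = 2, 3, …`; the summation index is `m = n + j`. -/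
def SecondStructureRelation (L : Lattice) (P : ℕ → ℂ[X]) : Prop :=
  ∃ b : ℕ → ℕ → ℂ, ∀ n : ℕ, 2 ≤ n →
    (P n = ∑ m ∈ Finset.Icc (n - 2) (n + 2), C (b n m) * L.D (L.D (P m))) ∧ b n (n + 2) ≠ 0

/-- `(a; q)_k = ∏_{j<k} (1 - a q^j)`. -/
def qPoch (a q : ℂ) (k : ℕ) : ℂ := ∏ j ∈ Finset.range k, (1 - a * q ^ j)

/-- `(a)_k = ∏_{j<k} (a + j)`. -/
def poch (a : ℂ) (k : ℕ) : ℂ := ∏ j ∈ Finset.range k, (a + j)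

/-- The Askey-Wilson polynomial `pₙ(X; a, b, c, d | q)`, for `a ≠ 0`:
`a^(-n) (ab, ac, ad; q)_n ₄φ₃(q^(-n), abcd q^(n-1), a e^(-iθ), a e^(iθ); ab, ac, ad; q, q)`,
`X = cos θ`, where `(ab; q)_n / (ab; q)_k` is written `(ab q^k; q)_{n-k}`, and
`(a e^(iθ), a e^(-iθ); q)_k = ∏_{j<k} (1 - 2 a q^j X + a² q^(2j))`. -/
def askeyWilson (q a b c d : ℂ) (n : ℕ) : ℂ[X] :=
  C ((a ^ n)⁻¹) * ∑ k ∈ Finset.range (n + 1),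
    C (qPoch (a * b * q ^ k) q (n - k) * qPoch (a * c * q ^ k) q (n - k) *
        qPoch (a * d * q ^ k) q (n - k) *
        (qPoch ((q ^ n)⁻¹) q k * qPoch (a * b * c * d * q ^ ((n : ℤ) - 1)) q k /
          qPoch q q k * q ^ k)) *
      ∏ j ∈ Finset.range k, (1 - C (2 * a * q ^ j) * X + C (a ^ 2 * q ^ (2 * j)))

/-- The continuous `q`-Hermite polynomial `Hₙ(X | q)` (the Askey-Wilson polynomial with
`a = b = c = d = 0`): `∑_{k=0}^n (q;q)_n / ((q;q)_k (q;q)_{n-k}) e^{i(n-2k)θ}`, `X = cos θ`; terms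
`k` and `n - k` combine, so that `e^{i(n-2k)θ}` may be replaced by
`cos((n-2k)θ) = T_{n-2k}(X)`. -/
def qHermite (q : ℂ) (n : ℕ) : ℂ[X] :=
  ∑ k ∈ Finset.range (n + 1),
    C (qPoch q q n / (qPoch q q k * qPoch q q (n - k))) *
      Polynomial.Chebyshev.T ℂ ((n : ℤ) - 2 * (k : ℤ))

/-- The Wilson polynomial `Wₙ(X; a, b, c, d)`:
`(a+b)_n (a+c)_n (a+d)_n ₄F₃(-n, n+a+b+c+d-1, a-it, a+it; a+b, a+c, a+d; 1)`, `X = t²`, where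
`(a+b)_n / (a+b)_k` is written `(a+b+k)_{n-k}`, and `(a-it)_k (a+it)_k = ∏_{j<k} ((a+j)² + X)`. -/
def wilson (a b c d : ℂ) (n : ℕ) : ℂ[X] :=
  ∑ k ∈ Finset.range (n + 1),
    C (poch (a + b + k) (n - k) * poch (a + c + k) (n - k) * poch (a + d + k) (n - k) *
        (poch (-(n : ℂ)) k * poch (n + a + b + c + d - 1) k / (k.factorial : ℂ))) *
      ∏ j ∈ Finset.range k, (C ((a + j) ^ 2) + X)

/-- The continuous dual Hahn polynomial `Sₙ(X; a, b, c)`: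
`(a+b)_n (a+c)_n ₃F₂(-n, a-it, a+it; a+b, a+c; 1)`, `X = t²`. -/
def dualHahn (a b c : ℂ) (n : ℕ) : ℂ[X] :=
  ∑ k ∈ Finset.range (n + 1),
    C (poch (a + b + k) (n - k) * poch (a + c + k) (n - k) *
        (poch (-(n : ℂ)) k / (k.factorial : ℂ))) *
      ∏ j ∈ Finset.range k, (C ((a + j) ^ 2) + X)

/-- A parameter which, along a sequence, converges in `ℂ` or tends to `∞`. -/
def FiniteOrInfiniteLimit (a : ℕ → ℂ) : Prop :=
  (∃ l : ℂ, Tendsto a atTop (𝓝 l)) ∨ Tendsto a atTop (Bornology.cobounded ℂ)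

/-- `Q` (with `deg Qₙ = n`) is a limit of the families `(p i)`, `i → ∞`, up to normalization:
for each `n`, suitable multiples of `p i n` converge to `Qₙ` coefficientwise. -/
def IsLimitFamily (p : ℕ → ℕ → ℂ[X]) (Q : ℕ → ℂ[X]) : Prop :=
  ∀ n : ℕ, (Q n).degree = n ∧ ∃ r : ℕ → ℂ, ∀ k : ℕ,
    Tendsto (fun i => r i * (p i n).coeff k) atTop (𝓝 ((Q n).coeff k))

/-- The members of the Askey-Wilson scheme in the variable `cos θ`: Askey-Wilson polynomials (with
the parameters for which `deg pₙ = n` for all `n`), the continuous `q`-Hermite polynomials, and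
the limiting cases in which parameters tend to `∞` (or to finite values). -/
inductive AskeyWilsonClass (q : ℂ) : (ℕ → ℂ[X]) → Prop
  | askeyWilson (a b c d : ℂ) (ha : a ≠ 0) (h : ∀ m : ℕ, a * b * c * d * q ^ m ≠ 1) :
      AskeyWilsonClass q (StructureRelation.askeyWilson q a b c d)
  | qHermite : AskeyWilsonClass q (StructureRelation.qHermite q)
  | limit (a b c d : ℕ → ℂ) (ha : ∀ i, a i ≠ 0)
      (h : ∀ i, ∀ m : ℕ, a i * b i * c i * d i * q ^ m ≠ 1)
      (hla : FiniteOrInfiniteLimit a) (hlb : FiniteOrInfiniteLimit b)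
      (hlc : FiniteOrInfiniteLimit c) (hld : FiniteOrInfiniteLimit d)
      (Q : ℕ → ℂ[X])
      (hQ : IsLimitFamily (fun i => StructureRelation.askeyWilson q (a i) (b i) (c i) (d i)) Q) :
      AskeyWilsonClass q Q

/-- The members of the Wilson scheme in the variable `t²`: Wilson polynomials (with the parameters
for which `deg Wₙ = n` for all `n`), continuous dual Hahn polynomials, and the limiting cases of
both in which parameters tend to `∞` (or to finite values). -/
inductive WilsonClass : (ℕ → ℂ[X]) → Prop
  | wilson (a b c d : ℂ) (h : ∀ m : ℕ, a + b + c + d + m ≠ 0) :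
      WilsonClass (StructureRelation.wilson a b c d)
  | dualHahn (a b c : ℂ) : WilsonClass (StructureRelation.dualHahn a b c)
  | wilsonLimit (a b c d : ℕ → ℂ) (h : ∀ i, ∀ m : ℕ, a i + b i + c i + d i + m ≠ 0)
      (hla : FiniteOrInfiniteLimit a) (hlb : FiniteOrInfiniteLimit b)
      (hlc : FiniteOrInfiniteLimit c) (hld : FiniteOrInfiniteLimit d)
      (Q : ℕ → ℂ[X])
      (hQ : IsLimitFamily (fun i => StructureRelation.wilson (a i) (b i) (c i) (d i)) Q) :
      WilsonClass Q
  | dualHahnLimit (a b c : ℕ → ℂ)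
      (hla : FiniteOrInfiniteLimit a) (hlb : FiniteOrInfiniteLimit b)
      (hlc : FiniteOrInfiniteLimit c)
      (Q : ℕ → ℂ[X])
      (hQ : IsLimitFamily (fun i => StructureRelation.dualHahn (a i) (b i) (c i)) Q) :
      WilsonClass Q

end StructureRelation

end

noncomputable section

namespace StructureRelation

/-! ### Degree bounds for the divided-difference operator. -/

namespace Lattice

/-! Proposition. Each application of `𝔻` lowers the degree, so `Q n = 𝔻² P (n+2)` has degree at most
`n`; orthogonality with nonzero norms forces degree exactly `n` (`coeff_ne_zero_of_orthogonal`), and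
`P n` is a combination of `Q 0, …, Q n`. With `φ f = ∫ f W`, the coefficient of `Q k` is `φ (P n * Q
k * π) / φ (Q k ^ 2 * π)`. It vanishes when `k + 4 < n`, since `deg (Q k * π) ≤ k + 4`
(`mem_span_of_orthogonal`). The surviving `Q (n-4), …, Q n` are exactly `𝔻² P (n-2), …, 𝔻² P (n+2)`.
The condition `b n (n+2) ≠ 0` is automatic: without the top term the right side has degree below `n`
(`secondStructureRelation_of_mem_span`).

Corollary. For general complex parameters no weight is at hand, so the argument is algebraic. A
half-step of the lattice maps the family with parameters `a, b, c, d` to a multiple of the same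
family with every parameter multiplied by `q^(1/2)` (Askey-Wilson, `D_askeyWilson_comp`) or
increased by `1/2` (Wilson, `D_wilson_comp`). Hence `𝔻²` shifts every parameter by a full step.
Conversely, a contiguous relation writes a polynomial through two consecutive ones with a single
parameter shifted; four of them in succession give the five-term band (`askeyWilson_mem_span_shift`,
`wilson_mem_span_shift`). The continuous `q`-Hermite family is mapped by `𝔻` to itself, so one term
suffices.

Limits. Belonging to a band is preserved under coefficientwise limits because the spanning
polynomials are triangular and their limits keep nonzero leading coefficients
(`mem_span_of_tendsto`). This needs `𝔻` to lower degrees by exactly one. The continuous dual Hahn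
case is itself obtained as a limit of Wilson polynomials. -/

theorem D_eq_of_isDividedDifference {L : Lattice} {f g : ℂ[X]} (h : L.IsDividedDifference f g) :
    L.D f = g :=
  (L.existsUnique_dividedDifference f).unique (L.D_spec f) h

/-- The divided-difference operator as a linear map. -/
def DLin (L : Lattice) : ℂ[X] →ₗ[ℂ] ℂ[X] where
  toFun := L.D
  map_add' f g := D_eq_of_isDividedDifference fun s => by
    have h1 := L.D_spec f s
    have h2 := L.D_spec g s
    simp only [eval_add]
    linear_combination h1 + h2
  map_smul' c f := D_eq_of_isDividedDifference fun s => by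
    have h1 := L.D_spec f s
    simp only [eval_smul, smul_eq_mul, RingHom.id_apply]
    linear_combination c * h1

@[simp] theorem DLin_apply (L : Lattice) (f : ℂ[X]) : L.DLin f = L.D f := rfl

/-- The sum `x(s+1/2) + x(s-1/2)` has degree at most one in `x(s)`, and the square of
`x(s+1/2) - x(s-1/2)` has degree at most two. -/
theorem exists_sum_sq_degree_le (L : Lattice) : ∃ A B : ℂ[X],
    A.natDegree ≤ 1 ∧ B.natDegree ≤ 2 ∧ ∀ s : ℂ,
      L.x (s + 1 / 2) + L.x (s - 1 / 2) = A.eval (L.x s) ∧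
      (L.x (s + 1 / 2) - L.x (s - 1 / 2)) ^ 2 = B.eval (L.x s) := by
  cases L with
  | qQuadratic q c₁ c₂ c₃ hq₀ hq₁ hc₁ =>
    obtain ⟨p, hp⟩ : ∃ p : ℂ, p = q ^ (1 / 2 : ℂ) := ⟨_, rfl⟩
    have hp0 : p ≠ 0 := by
      rw [hp]; exact (Complex.cpow_ne_zero_iff_of_exponent_ne_zero (by norm_num)).2 hq₀
    refine ⟨C (p + p⁻¹) * (X - C c₃) + C (2 * c₃),
      C ((p - p⁻¹) ^ 2) * ((X - C c₃) ^ 2 - C (4 * c₁ * c₂)), by compute_degree,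
      by compute_degree, ?_⟩
    intro s
    have e1 : q ^ (s + 1 / 2) = q ^ s * p := by rw [hp, Complex.cpow_add _ _ hq₀]
    have e2 : q ^ (s - 1 / 2) = q ^ s * p⁻¹ := by
      rw [hp, Complex.cpow_sub _ _ hq₀, div_eq_mul_inv]
    have hz : q ^ s ≠ 0 := by simp [Complex.cpow_eq_zero_iff, hq₀]
    simp only [x, Complex.cpow_neg, e1, e2]
    constructor
    · simp only [eval_add, eval_mul, eval_sub, eval_C, eval_X]
      field_simp
      ring
    · simp only [eval_mul, eval_sub, eval_C, eval_X, eval_pow]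
      field_simp
      ring
  | quadratic c₄ c₅ c₆ hc₄ =>
    refine ⟨C 2 * X + C (c₄ / 2), C (4 * c₄) * X + C (c₅ ^ 2 - 4 * c₄ * c₆), by compute_degree,
      by compute_degree!, ?_⟩
    intro s
    simp only [x, eval_add, eval_mul, eval_C, eval_X]
    constructor <;> ring

/-- The product rule for difference quotients involves averages, so the induction carries the
quotient `g` and the average `h` of `X ^ n` together. The recursion `g ↦ A g / 2 + h`, `h ↦ A h / 2
+ B g / 4` preserves `deg g < n`, `deg h ≤ n` because `deg A ≤ 1` and `deg B ≤ 2`. -/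
theorem D_X_pow_mem_degreeLT (L : Lattice) (n : ℕ) : L.D (X ^ n) ∈ degreeLT ℂ n := by
  obtain ⟨A, B, hA, hB, hAB⟩ := L.exists_sum_sq_degree_le
  have hA' : A.degree ≤ 1 := natDegree_le_iff_degree_le.1 hA
  have hB' : B.degree ≤ 2 := natDegree_le_iff_degree_le.1 hB
  have key : ∃ g h : ℂ[X], L.IsDividedDifference (X ^ n) g ∧ (∀ s : ℂ,
      2 * h.eval (L.x s) = (X ^ n : ℂ[X]).eval (L.x (s + 1 / 2)) +
        (X ^ n : ℂ[X]).eval (L.x (s - 1 / 2))) ∧ g.degree < n ∧ h.degree ≤ n := by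
    induction n with
    | zero => exact ⟨0, 1, fun s => by simp, fun s => by simp; norm_num, by simp, by simp⟩
    | succ n ih =>
      obtain ⟨g, h, hg, hh, dg, dh⟩ := ih
      -- The case split covers `g = 0`, of degree `⊥`.
      have dg' : g.degree + 1 ≤ n := by
        generalize g.degree = e at dg
        cases e with
        | bot => simp
        | coe e =>
          rw [← Nat.cast_withBot] at dg ⊢
          exact_mod_cast Nat.succ_le_of_lt (Nat.cast_lt.1 dg)
      have hc (c : ℂ) : (C c : ℂ[X]).degree ≤ 0 := degree_C_le
      refine ⟨C (1 / 2) * A * g + h, C (1 / 2) * A * h + C (1 / 4) * B * g,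
        fun s => ?_, fun s => ?_, ?_, ?_⟩
      · have h1 := hg s
        have h2 := hh s
        obtain ⟨h3, h4⟩ := hAB s
        simp only [eval_add, eval_mul, eval_C, eval_pow, eval_X, pow_succ] at h1 h2 ⊢
        rw [← h3]
        linear_combination (1 / 2) * (L.x (s + 1 / 2) + L.x (s - 1 / 2)) * h1 +
          (1 / 2) * (L.x (s + 1 / 2) - L.x (s - 1 / 2)) * h2
      · have h1 := hg s
        have h2 := hh s
        obtain ⟨h3, h4⟩ := hAB s
        simp only [eval_add, eval_mul, eval_C, eval_pow, eval_X, pow_succ] at h1 h2 ⊢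
        rw [← h3, ← h4]
        linear_combination (1 / 2) * (L.x (s + 1 / 2) + L.x (s - 1 / 2)) * h2 +
          (1 / 2) * (L.x (s + 1 / 2) - L.x (s - 1 / 2)) * h1
      · refine lt_of_le_of_lt (b := (n : WithBot ℕ)) ?_ (by exact_mod_cast n.lt_succ_self)
        refine (degree_add_le _ _).trans (max_le ?_ dh)
        calc (C (1 / 2) * A * g).degree ≤ 0 + 1 + g.degree := by
              rw [degree_mul, degree_mul]; gcongr; exact hc _
          _ = g.degree + 1 := by rw [zero_add, add_comm]
          _ ≤ n := dg'
      · refine (degree_add_le _ _).trans (max_le ?_ ?_)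
        · calc (C (1 / 2) * A * h).degree ≤ 0 + 1 + (n : WithBot ℕ) := by
                rw [degree_mul, degree_mul]; gcongr; exact hc _
            _ = ((n + 1 : ℕ) : WithBot ℕ) := by push_cast; ring
        · calc (C (1 / 4) * B * g).degree ≤ 0 + 2 + g.degree := by
                rw [degree_mul, degree_mul]; gcongr; exact hc _
            _ = (g.degree + 1) + 1 := by
                rw [zero_add, add_comm, add_assoc]; norm_num
            _ ≤ ((n + 1 : ℕ) : WithBot ℕ) := by push_cast; gcongr
  obtain ⟨g, h, hg, -, dg, -⟩ := key
  rw [D_eq_of_isDividedDifference hg, mem_degreeLT]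
  exact dg

theorem D_mem_degreeLT (L : Lattice) {n : ℕ} {f : ℂ[X]} (hf : f ∈ degreeLT ℂ (n + 1)) :
    L.D f ∈ degreeLT ℂ n := by
  rw [mem_degreeLT, degree_lt_iff_coeff_zero] at hf
  rw [← L.DLin_apply, f.as_sum_range' (n + 1) (by
    rw [Nat.lt_succ_iff, natDegree_le_iff_coeff_eq_zero]
    exact fun N hN => hf N hN), map_sum]
  refine Submodule.sum_mem _ fun k hk => ?_
  rw [← C_mul_X_pow_eq_monomial, ← smul_eq_C_mul, map_smul]
  exact Submodule.smul_mem _ _ (degreeLT_mono (Nat.lt_succ_iff.1 (Finset.mem_range.1 hk))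
    (L.D_X_pow_mem_degreeLT k))

theorem D_D_mem_degreeLT (L : Lattice) {n : ℕ} {f : ℂ[X]} (hf : f ∈ degreeLT ℂ (n + 2)) :
    L.D (L.D f) ∈ degreeLT ℂ n :=
  L.D_mem_degreeLT (L.D_mem_degreeLT hf)

end Lattice

/-! ### Triangular families of polynomials. -/

theorem mem_degreeLT_succ_of_degree_eq {f : ℂ[X]} {n : ℕ} (h : f.degree = n) :
    f ∈ degreeLT ℂ (n + 1) := by
  rw [mem_degreeLT, h]; exact_mod_cast n.lt_succ_self

theorem mem_degreeLT_of_coeff_eq_zero {f : ℂ[X]} {n : ℕ} (hf : f ∈ degreeLT ℂ (n + 1))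
    (h : f.coeff n = 0) : f ∈ degreeLT ℂ n := by
  rw [mem_degreeLT, degree_lt_iff_coeff_zero] at hf ⊢
  intro m hm
  rcases hm.eq_or_lt with rfl | hm
  · exact h
  · exact hf m hm

theorem coeff_eq_zero_of_mem_degreeLT {f : ℂ[X]} {n : ℕ} (hf : f ∈ degreeLT ℂ n) :
    f.coeff n = 0 := by
  rw [mem_degreeLT, degree_lt_iff_coeff_zero] at hf
  exact hf n le_rfl

/-- A polynomial of degree at most `n` differs from a multiple of a polynomial of exact degree `n`
by a polynomial of smaller degree. -/
theorem sub_smul_mem_degreeLT {f g : ℂ[X]} {n : ℕ} (hf : f ∈ degreeLT ℂ (n + 1))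
    (hg : g ∈ degreeLT ℂ (n + 1)) (h : g.coeff n ≠ 0) :
    f - (f.coeff n / g.coeff n) • g ∈ degreeLT ℂ n := by
  refine mem_degreeLT_of_coeff_eq_zero (sub_mem hf (Submodule.smul_mem _ _ hg)) ?_
  simp [h]

theorem exists_sum_of_mem_span_image {ι M : Type*} [AddCommGroup M] [Module ℂ M]
    {s : Finset ι} {v : ι → M} {x : M} (h : x ∈ Submodule.span ℂ (v '' (s : Set ι))) :
    ∃ β : ι → ℂ, ∑ i ∈ s, β i • v i = x := by
  rw [Finsupp.mem_span_image_iff_linearCombination] at h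
  obtain ⟨l, hl, rfl⟩ := h
  refine ⟨l, ?_⟩
  rw [Finsupp.linearCombination_apply, Finsupp.sum]
  refine (Finset.sum_subset (by exact_mod_cast hl) fun i _ hi => ?_).symm
  rw [Finsupp.notMem_support_iff.1 hi, zero_smul]

/-- Polynomials `Q 0, Q 1, …` with `deg (Q n) = n` span all polynomials, degree by degree. -/
theorem degreeLT_le_span {Q : ℕ → ℂ[X]} {n : ℕ} (hQ : ∀ k < n, Q k ∈ degreeLT ℂ (k + 1))
    (hc : ∀ k < n, (Q k).coeff k ≠ 0) : degreeLT ℂ n ≤ Submodule.span ℂ (Q '' Set.Iio n) := by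
  induction n with
  | zero =>
    intro f hf
    rw [mem_degreeLT, degree_lt_iff_coeff_zero] at hf
    have : f = 0 := by ext k; simpa using hf k (Nat.zero_le k)
    rw [this]; exact zero_mem _
  | succ n ih =>
    intro f hf
    have h1 := ih (fun k hk => hQ k (by omega)) (fun k hk => hc k (by omega))
      (sub_smul_mem_degreeLT hf (hQ n (by omega)) (hc n (by omega)))
    have h2 : Submodule.span ℂ (Q '' Set.Iio n) ≤ Submodule.span ℂ (Q '' Set.Iio (n + 1)) :=
      Submodule.span_mono (Set.image_mono (Set.Iio_subset_Iio (Nat.le_succ n)))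
    rw [← sub_add_cancel f ((f.coeff n / (Q n).coeff n) • Q n)]
    exact add_mem (h2 h1) (Submodule.smul_mem _ _ (Submodule.subset_span ⟨n, by simp, rfl⟩))

/-! ### Orthogonality and the Proposition. -/

/-- Polynomials with `deg (Q n) ≤ n` which are orthogonal for a functional with nonzero square
norms have exact degree `n`. -/
theorem coeff_ne_zero_of_orthogonal (φ : ℂ[X] →ₗ[ℂ] ℂ) (Q : ℕ → ℂ[X])
    (hdeg : ∀ n, Q n ∈ degreeLT ℂ (n + 1)) (hQ : ∀ m n, m ≠ n → φ (Q m * Q n) = 0)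
    (hn : ∀ n, φ (Q n * Q n) ≠ 0) (n : ℕ) : (Q n).coeff n ≠ 0 := by
  induction n using Nat.strong_induction_on with
  | _ n ih =>
    -- With vanishing top coefficient, `Q n` would lie in the span of the earlier members, all
    -- orthogonal to it, hence be orthogonal to itself.
    intro h0
    apply hn n
    have h1 := degreeLT_le_span (fun k _ => hdeg k) ih
      (mem_degreeLT_of_coeff_eq_zero (hdeg n) h0)
    have h2 : Submodule.span ℂ (Q '' Set.Iio n) ≤
        LinearMap.ker (φ ∘ₗ LinearMap.mulRight ℂ (Q n)) := by
      rw [Submodule.span_le]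
      rintro _ ⟨k, hk, rfl⟩
      simpa using hQ k n (ne_of_lt hk)
    simpa using h2 h1

/-- If `P` is orthogonal for `φ` and `Q` is orthogonal for `f ↦ φ (f π)`, `deg π ≤ 4`, then
`P n` is a combination of `Q (n-4), …, Q n`. -/
theorem mem_span_of_orthogonal (φ : ℂ[X] →ₗ[ℂ] ℂ) (π : ℂ[X]) (P Q : ℕ → ℂ[X])
    (hP : ∀ n, (P n).degree = n) (hQ : ∀ n, Q n ∈ degreeLT ℂ (n + 1))
    (oP : ∀ m n, m ≠ n → φ (P m * P n) = 0) (hπ : π.natDegree ≤ 4)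
    (oQ : ∀ m n, m ≠ n → φ (Q m * Q n * π) = 0) (nQ : ∀ n, φ (Q n * Q n * π) ≠ 0) (n : ℕ) :
    P n ∈ Submodule.span ℂ (Q '' Set.Icc (n - 4) n) := by
  have cP (k : ℕ) : (P k).coeff k ≠ 0 := by
    exact coeff_ne_zero_of_eq_degree (hP k)
  have cQ := coeff_ne_zero_of_orthogonal (φ ∘ₗ LinearMap.mulRight ℂ π) Q hQ
    (by simpa using oQ) (by simpa using nQ)
  -- Lower-degree polynomials are combinations of `P 0, …, P (n-1)`.
  have lowP (f : ℂ[X]) (hf : f ∈ degreeLT ℂ n) : φ (P n * f) = 0 := by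
    have h1 := degreeLT_le_span (fun k _ => mem_degreeLT_succ_of_degree_eq (hP k))
      (fun k _ => cP k) hf
    have h2 : Submodule.span ℂ (P '' Set.Iio n) ≤
        LinearMap.ker (φ ∘ₗ LinearMap.mulLeft ℂ (P n)) := by
      rw [Submodule.span_le]
      rintro _ ⟨k, hk, rfl⟩
      simpa using oP n k (ne_of_gt hk)
    simpa using h2 h1
  have hmem := degreeLT_le_span (n := n + 1) (fun k _ => hQ k) (fun k _ => cQ k)
    (mem_degreeLT_succ_of_degree_eq (hP n))
  rw [show Set.Iio (n + 1) = ((Finset.range (n + 1) : Finset ℕ) : Set ℕ) by ext; simp] at hmem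
  obtain ⟨β, hβ⟩ := exists_sum_of_mem_span_image hmem
  rw [← hβ]
  refine Submodule.sum_mem _ fun k hk => ?_
  have hk' := Finset.mem_range.1 hk
  by_cases h4 : n ≤ k + 4
  · exact Submodule.smul_mem _ _ (Submodule.subset_span ⟨k, ⟨by omega, by omega⟩, rfl⟩)
  -- Pairing the expansion with `Q k * π` isolates `β k`; the left side is zero because `deg (Q k *
  -- π) < n`.
  · have e1 : φ (P n * (Q k * π)) = β k * φ (Q k * Q k * π) := by
      rw [← hβ, Finset.sum_mul, map_sum, Finset.sum_eq_single k]
      · rw [smul_mul_assoc, map_smul, smul_eq_mul, mul_assoc]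
      · intro j _ hj
        rw [smul_mul_assoc, map_smul, ← mul_assoc, oQ j k hj, smul_zero]
      · exact fun h => absurd hk h
    rw [lowP] at e1
    · have : β k = 0 := by
        rcases mul_eq_zero.1 e1.symm with h | h
        · exact h
        · exact absurd h (nQ k)
      rw [this, zero_smul]; exact zero_mem _
    · rw [mem_degreeLT]
      have hq := hQ k
      rw [mem_degreeLT, degree_lt_iff_coeff_zero] at hq
      have hq' : (Q k).degree ≤ k := (degree_le_iff_coeff_zero _ _).2 fun m hm =>
        hq m (Nat.cast_lt.1 hm)
      calc (Q k * π).degree ≤ k + 4 := by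
            rw [degree_mul]; gcongr; exact natDegree_le_iff_degree_le.1 hπ
        _ < n := by exact_mod_cast (not_le.1 h4)

/-- The functional `f ↦ ∫ f w` on polynomials, for a weight with finite moments. -/
def momentFunctional (s : Set ℝ) (w : ℝ → ℂ)
    (hw : ∀ k : ℕ, IntegrableOn (fun t : ℝ => (t : ℂ) ^ k * w t) s) : ℂ[X] →ₗ[ℂ] ℂ :=
  have hint (f : ℂ[X]) : IntegrableOn (fun t : ℝ => f.eval (t : ℂ) * w t) s := by
    have : (fun t : ℝ => f.eval (t : ℂ) * w t) = fun t : ℝ =>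
        ∑ k ∈ Finset.range (f.natDegree + 1), f.coeff k * ((t : ℂ) ^ k * w t) := by
      funext t
      rw [eval_eq_sum_range, Finset.sum_mul]
      exact Finset.sum_congr rfl fun k _ => mul_assoc _ _ _
    rw [this]
    exact integrable_finsetSum _ fun k _ => (hw k).const_mul _
  { toFun := fun f => ∫ t in s, f.eval (t : ℂ) * w t
    map_add' := fun f g => by
      simp only [eval_add, add_mul]
      exact integral_add (hint f) (hint g)
    map_smul' := fun c f => by
      simp only [eval_smul, smul_eq_mul, mul_assoc, RingHom.id_apply]
      exact integral_const_mul c _ }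

theorem momentFunctional_apply (s : Set ℝ) (w : ℝ → ℂ)
    (hw : ∀ k : ℕ, IntegrableOn (fun t : ℝ => (t : ℂ) ^ k * w t) s) (f : ℂ[X]) :
    momentFunctional s w hw f = ∫ t in s, f.eval (t : ℂ) * w t := rfl

/-- A sequence with `deg (P n) = n` satisfies the second structure relation as soon as each `P n`
is a combination of `𝔻² P (n-2), …, 𝔻² P (n+2)`. -/
theorem secondStructureRelation_of_mem_span {L : Lattice} {P : ℕ → ℂ[X]}
    (hP : ∀ n, (P n).degree = n)
    (h : ∀ n, 2 ≤ n →
      P n ∈ Submodule.span ℂ ((fun m => L.D (L.D (P m))) '' Set.Icc (n - 2) (n + 2))) :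
    SecondStructureRelation L P := by
  -- The bound on `n` sits inside the existential so that `choose` yields coefficients for every
  -- `n`, arbitrary below `2`.
  have key (n : ℕ) : ∃ β : ℕ → ℂ, 2 ≤ n →
      (P n = ∑ m ∈ Finset.Icc (n - 2) (n + 2), C (β m) * L.D (L.D (P m))) ∧ β (n + 2) ≠ 0 := by
    by_cases hn : 2 ≤ n
    · have h1 := h n hn
      rw [← Finset.coe_Icc] at h1
      obtain ⟨β, hβ⟩ := exists_sum_of_mem_span_image h1
      refine ⟨β, fun _ => ⟨by simp only [← smul_eq_C_mul]; exact hβ.symm, fun h0 => ?_⟩⟩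
      -- Without the top term only `m ≤ n + 1` remains, and there `𝔻² P m` has degree below `n`.
      have h2 : P n ∈ degreeLT ℂ n := by
        rw [← hβ]
        refine Submodule.sum_mem _ fun m hm => ?_
        have hm' := Finset.mem_Icc.1 hm
        rcases hm'.2.eq_or_lt with rfl | hlt
        · rw [h0, zero_smul]; exact zero_mem _
        · refine Submodule.smul_mem _ _ (L.D_D_mem_degreeLT ?_)
          exact degreeLT_mono (by omega) (mem_degreeLT_succ_of_degree_eq (hP m))
      rw [mem_degreeLT, hP n] at h2
      exact lt_irrefl _ h2
    · exact ⟨0, fun h => absurd h hn⟩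
  choose b hb using key
  exact ⟨b, hb⟩

/-- Both orthogonalities are read through the moment functional of `W`, with `π` moved from the
weight into the argument. The index shift `k ↦ k + 2` turns the band `n - 4, …, n` into `n - 2, …, n
+ 2`. -/
theorem secondStructureRelation_of_isOrthogonal (L : Lattice) (a b : EReal) (W : ℝ → ℂ)
    (P : ℕ → ℂ[X]) (π : ℂ[X]) (hP : ∀ n, (P n).degree = n) (hW : IsOrthogonal a b W P)
    (hπ : π.natDegree ≤ 4)
    (hπW : IsOrthogonal a b (fun t => π.eval (t : ℂ) * W t) (fun n => L.D (L.D (P (n + 2))))) :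
    SecondStructureRelation L P := by
  refine secondStructureRelation_of_mem_span hP fun n _ => ?_
  have h := mem_span_of_orthogonal (momentFunctional _ W hW.integrable) π P
    (fun n => L.D (L.D (P (n + 2)))) hP
    (fun n => L.D_D_mem_degreeLT (mem_degreeLT_succ_of_degree_eq (hP (n + 2))))
    (fun m k hmk => by
      simpa only [momentFunctional_apply, eval_mul] using hW.orthogonal m k hmk) hπ
    (fun m k hmk => by
      simpa only [momentFunctional_apply, eval_mul, mul_assoc] using hπW.orthogonal m k hmk)
    (fun k => by
      simpa only [momentFunctional_apply, eval_mul, mul_assoc, pow_two]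
        using hπW.norm_ne_zero k) n
  refine Submodule.span_mono ?_ h
  rintro _ ⟨k, hk, rfl⟩
  exact ⟨k + 2, ⟨by have := hk.1; omega, by have := hk.2; omega⟩, rfl⟩

/-! ### Coefficientwise limits. -/

/-- Under a uniform degree bound, each coefficient of the image is a fixed finite linear combination
of the coefficients of the argument. -/
theorem tendsto_coeff_map (T : ℂ[X] →ₗ[ℂ] ℂ[X]) {f : ℕ → ℂ[X]} {g : ℂ[X]} {N : ℕ}
    (hf : ∀ i, f i ∈ degreeLT ℂ N) (hg : g ∈ degreeLT ℂ N)
    (h : ∀ k, Tendsto (fun i => (f i).coeff k) atTop (𝓝 (g.coeff k))) (k : ℕ) :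
    Tendsto (fun i => (T (f i)).coeff k) atTop (𝓝 ((T g).coeff k)) := by
  have expand (u : ℂ[X]) (hu : u ∈ degreeLT ℂ N) :
      (T u).coeff k = ∑ j ∈ Finset.range N, u.coeff j * (T (X ^ j)).coeff k := by
    have hu' : u = ∑ j ∈ Finset.range N, u.coeff j • (X ^ j : ℂ[X]) := by
      rw [mem_degreeLT, degree_lt_iff_coeff_zero] at hu
      ext m
      simp only [finsetSum_coeff, coeff_smul, coeff_X_pow, smul_eq_mul, mul_ite, mul_one,
        mul_zero, Finset.sum_ite_eq, Finset.mem_range]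
      split_ifs with hm
      · rfl
      · exact hu m (not_lt.1 hm)
    conv_lhs => rw [hu']
    simp
  simp only [expand _ (hf _), expand _ hg]
  exact tendsto_finsetSum _ fun j _ => (h j).mul_const _

/-- Membership in the span of a triangular family of polynomials is preserved under
coefficientwise limits. -/
theorem mem_span_of_tendsto {v : ℕ → ℕ → ℂ[X]} {w : ℕ → ℂ[X]}
    (hv : ∀ i m, v i m ∈ degreeLT ℂ (m + 1))
    (hlim : ∀ m k, Tendsto (fun i => (v i m).coeff k) atTop (𝓝 ((w m).coeff k)))
    (hw : ∀ m, (w m).coeff m ≠ 0) (l n : ℕ) {u : ℕ → ℂ[X]} {U : ℂ[X]}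
    (hu : ∀ k, Tendsto (fun i => (u i).coeff k) atTop (𝓝 (U.coeff k)))
    (hmem : ∀ᶠ i in atTop, u i ∈ Submodule.span ℂ (v i '' Set.Ico l n)) :
    U ∈ Submodule.span ℂ (w '' Set.Ico l n) := by
  induction n generalizing u U with
  | zero =>
    have : U = 0 := by
      ext k
      refine tendsto_nhds_unique (hu k) (Tendsto.congr' ?_ tendsto_const_nhds)
      filter_upwards [hmem] with i hi
      have : u i = 0 := by simpa using hi
      rw [this]
    rw [this]; exact zero_mem _
  | succ n ih =>
    by_cases hl : l ≤ n
    · have hins : Set.Ico l (n + 1) = insert n (Set.Ico l n) := by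
        ext j; simp only [Set.mem_Ico, Set.mem_insert_iff]; omega
      have hne : ∀ᶠ i in atTop, (v i n).coeff n ≠ 0 := (hlim n n).eventually_ne (hw n)
      -- The top term is eliminated before passing to the limit. The quotient of leading
      -- coefficients converges because its denominator has a nonzero limit; this is where
      -- degeneration of the spans is excluded.
      have key := ih (u := fun i => u i - ((u i).coeff n / (v i n).coeff n) • v i n)
        (U := U - (U.coeff n / (w n).coeff n) • w n) (fun k => by
          simp only [coeff_sub, coeff_smul, smul_eq_mul]
          exact (hu k).sub (((hu n).div (hlim n n) (hw n)).mul (hlim n k))) (by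
          filter_upwards [hmem, hne] with i hi hi0
          rw [hins, Set.image_insert_eq, Submodule.mem_span_insert] at hi
          obtain ⟨a, z, hz, hz'⟩ := hi
          have hzd : z ∈ degreeLT ℂ n := by
            refine (Submodule.span_le.2 ?_ : Submodule.span ℂ (v i '' Set.Ico l n) ≤ _) hz
            rintro _ ⟨k, hk, rfl⟩
            exact degreeLT_mono hk.2 (hv i k)
          -- By triangularity only `v i n` contributes in degree `n`.
          have ha : (u i).coeff n / (v i n).coeff n = a := by
            rw [hz', coeff_add, coeff_eq_zero_of_mem_degreeLT hzd, coeff_smul, smul_eq_mul,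
              add_zero, mul_div_cancel_right₀ _ hi0]
          rw [ha, hz', add_sub_cancel_left]
          exact hz)
      rw [hins, Set.image_insert_eq, Submodule.mem_span_insert]
      exact ⟨_, _, key, (add_sub_cancel _ _).symm⟩
    · have hI : Set.Ico l (n + 1) = Set.Ico l n := by
        ext j; simp only [Set.mem_Ico]; omega
      rw [hI] at hmem ⊢
      exact ih hu hmem

/-- `L.D` lowers the degree of a nonconstant polynomial by exactly one. -/
def Lattice.LowersDegree (L : Lattice) : Prop :=
  ∀ (n : ℕ) (f : ℂ[X]), f ∈ degreeLT ℂ (n + 2) → f.coeff (n + 1) ≠ 0 → (L.D f).coeff n ≠ 0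

/-- Modulo lower degree, `f` is a nonzero multiple of `Φ (n + 1)`, and `𝔻` sends the remainder below
degree `n`. So one graded basis decides the matter. -/
theorem Lattice.lowersDegree_of_basis {L : Lattice} (Φ : ℕ → ℂ[X])
    (hΦ : ∀ n, Φ n ∈ degreeLT ℂ (n + 1)) (hc : ∀ n, (Φ n).coeff n ≠ 0)
    (hD : ∀ n, (L.D (Φ (n + 1))).coeff n ≠ 0) : L.LowersDegree := by
  intro n f hf hfc
  have h1 := L.D_mem_degreeLT (sub_smul_mem_degreeLT hf (hΦ (n + 1)) (hc (n + 1)))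
  have h2 := coeff_eq_zero_of_mem_degreeLT h1
  rw [← L.DLin_apply, map_sub, map_smul, coeff_sub, coeff_smul, sub_eq_zero] at h2
  rw [← L.DLin_apply, h2, smul_eq_mul]
  exact mul_ne_zero (div_ne_zero hfc (hc _)) (hD n)

/-- Composition with `F` as a linear map. -/
def compLin (F : ℂ[X]) : ℂ[X] →ₗ[ℂ] ℂ[X] where
  toFun f := f.comp F
  map_add' _ _ := add_comp
  map_smul' c f := by simp only [smul_comp, RingHom.id_apply]

@[simp] theorem compLin_apply (F f : ℂ[X]) : compLin F f = f.comp F := rfl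

theorem IsLimitFamily.comp {p : ℕ → ℕ → ℂ[X]} {Q : ℕ → ℂ[X]} (h : IsLimitFamily p Q)
    (hp : ∀ i n, p i n ∈ degreeLT ℂ (n + 1)) {F : ℂ[X]} (hF : F.natDegree = 1) :
    IsLimitFamily (fun i n => (p i n).comp F) (fun n => (Q n).comp F) := by
  intro n
  obtain ⟨hQ, r, hr⟩ := h n
  have hF0 : F ≠ 0 := by rintro rfl; simp at hF
  constructor
  · have hQ0 : Q n ≠ 0 := by rintro h0; rw [h0] at hQ; simp at hQ
    have hn : (Q n).natDegree = n := natDegree_eq_of_degree_eq_some hQ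
    have hne : (Q n).comp F ≠ 0 := by
      rw [Ne, comp_eq_zero_iff]
      rintro (h0 | ⟨-, h0⟩)
      · exact hQ0 h0
      · rw [h0] at hF; simp at hF
    rw [degree_eq_natDegree hne, natDegree_comp, hF, mul_one, hn]
  · refine ⟨r, fun k => ?_⟩
    have := tendsto_coeff_map (compLin F) (f := fun i => r i • p i n) (g := Q n)
      (N := n + 1) (fun i => Submodule.smul_mem _ _ (hp i n)) (mem_degreeLT_succ_of_degree_eq hQ)
      (by simpa using hr) k
    simpa using this

/-- The second structure relation passes to coefficientwise limits. -/
theorem SecondStructureRelation.of_isLimitFamily {L : Lattice} (hL : L.LowersDegree)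
    {p : ℕ → ℕ → ℂ[X]} {Q : ℕ → ℂ[X]} (h : IsLimitFamily p Q)
    (hp : ∀ i n, p i n ∈ degreeLT ℂ (n + 1)) (hS : ∀ i, SecondStructureRelation L (p i)) :
    SecondStructureRelation L Q := by
  have hQ (n : ℕ) := (h n).1
  choose r hr using fun n => (h n).2
  have cQ (n : ℕ) : (Q n).coeff n ≠ 0 := coeff_ne_zero_of_eq_degree (hQ n)
  refine secondStructureRelation_of_mem_span hQ fun n hn => ?_
  have hR (i m : ℕ) : r m i • p i m ∈ degreeLT ℂ (m + 1) := Submodule.smul_mem _ _ (hp i m)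
  -- A vanishing multiplier would make the leading coefficient vanish, although its limit is
  -- nonzero.
  have hr0 (m : ℕ) : ∀ᶠ i in atTop, r m i ≠ 0 := by
    filter_upwards [(hr m m).eventually_ne (cQ m)] with i hi h0
    exact hi (by rw [h0, zero_mul])
  -- Indexing by `m + 2` makes the family triangular: its `m`-th member has degree at most `m`, and
  -- exactly `m` in the limit.
  have key := mem_span_of_tendsto (v := fun i m => L.D (L.D (r (m + 2) i • p i (m + 2))))
    (w := fun m => L.D (L.D (Q (m + 2)))) (u := fun i => r n i • p i n) (U := Q n)
    (fun i m => L.D_D_mem_degreeLT (hR i (m + 2)))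
    (fun m k => tendsto_coeff_map (L.DLin ∘ₗ L.DLin) (f := fun i => r (m + 2) i • p i (m + 2))
      (fun i => hR i (m + 2)) (mem_degreeLT_succ_of_degree_eq (hQ (m + 2)))
      (by simpa using hr (m + 2)) k)
    (fun m => hL m _ (L.D_mem_degreeLT (mem_degreeLT_succ_of_degree_eq (hQ (m + 2))))
      (hL (m + 1) _ (mem_degreeLT_succ_of_degree_eq (hQ (m + 2))) (cQ (m + 2))))
    (n - 4) (n + 1) (by simpa using hr n) (by
      have hall : ∀ᶠ i in atTop, ∀ m ∈ Finset.range (n + 3), r m i ≠ 0 :=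
        (Finset.eventually_all _).2 fun m _ => hr0 m
      filter_upwards [hall] with i hi
      refine Submodule.smul_mem _ _ ?_
      obtain ⟨b, hb⟩ := hS i
      rw [(hb n hn).1]
      refine Submodule.sum_mem _ fun m hm => ?_
      obtain ⟨hm1, hm2⟩ := Finset.mem_Icc.1 hm
      rw [← smul_eq_C_mul]
      refine Submodule.smul_mem _ _ ?_
      rcases lt_or_ge m 2 with h2 | h2
      -- The indices `m = 0, 1` occur for `n = 2, 3`; there `𝔻²` gives zero.
      · have : L.D (L.D (p i m)) ∈ degreeLT ℂ 0 :=
          L.D_D_mem_degreeLT (degreeLT_mono (by omega) (hp i m))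
        rw [mem_degreeLT, degree_lt_iff_coeff_zero] at this
        have h0 : L.D (L.D (p i m)) = 0 := by ext k; simpa using this k (Nat.zero_le k)
        rw [h0]; exact zero_mem _
      · obtain ⟨j, rfl⟩ := Nat.exists_eq_add_of_le' h2
        have hj : L.D (L.D (p i (j + 2))) =
            (r (j + 2) i)⁻¹ • L.D (L.D (r (j + 2) i • p i (j + 2))) := by
          simp only [← L.DLin_apply, map_smul]
          rw [smul_smul, inv_mul_cancel₀ (hi _ (by simp; omega)), one_smul]
        rw [hj]
        exact Submodule.smul_mem _ _ (Submodule.subset_span ⟨j, ⟨by omega, by omega⟩, rfl⟩))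
  refine Submodule.span_mono ?_ key
  rintro _ ⟨k, hk, rfl⟩
  exact ⟨k + 2, ⟨by have := hk.1; omega, by have := hk.2; omega⟩, rfl⟩

/-! ### Banded expansions and affine substitutions. -/

/-- Banded expansions compose. -/
theorem mem_span_Icc_trans {f g h : ℕ → ℂ[X]} {i j : ℕ}
    (hfg : ∀ n, f n ∈ Submodule.span ℂ (g '' Set.Icc (n - i) n))
    (hgh : ∀ n, g n ∈ Submodule.span ℂ (h '' Set.Icc (n - j) n)) (n : ℕ) :
    f n ∈ Submodule.span ℂ (h '' Set.Icc (n - (i + j)) n) := by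
  refine (Submodule.span_le.2 ?_ : Submodule.span ℂ (g '' Set.Icc (n - i) n) ≤ _) (hfg n)
  rintro _ ⟨k, ⟨hk1, hk2⟩, rfl⟩
  refine Submodule.span_mono (Set.image_mono (Set.Icc_subset_Icc ?_ hk2)) (hgh k)
  omega

theorem prod_linear_mem_degreeLT (α β : ℕ → ℂ) (k : ℕ) :
    ∏ j ∈ Finset.range k, (C (α j) + C (β j) * X) ∈ degreeLT ℂ (k + 1) := by
  rw [mem_degreeLT, Nat.cast_succ]
  have h : (∏ j ∈ Finset.range k, (C (α j) + C (β j) * X)).natDegree ≤ k := by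
    refine (natDegree_prod_le _ _).trans ((Finset.sum_le_sum (g := fun _ => 1) fun j _ => ?_).trans
      (by simp))
    compute_degree
  refine lt_of_le_of_lt (natDegree_le_iff_degree_le.1 h) ?_
  exact_mod_cast k.lt_succ_self

theorem prod_linear_coeff (α β : ℕ → ℂ) (k : ℕ) :
    (∏ j ∈ Finset.range k, (C (α j) + C (β j) * X)).coeff k = ∏ j ∈ Finset.range k, β j := by
  have h := coeff_prod_of_natDegree_le (Finset.range k) (fun j => C (α j) + C (β j) * X) 1
    (fun j _ => by compute_degree)
  simpa [coeff_C] using h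

theorem comp_mem_degreeLT {f F : ℂ[X]} {n : ℕ} (hF : F.natDegree = 1)
    (hf : f ∈ degreeLT ℂ (n + 1)) : f.comp F ∈ degreeLT ℂ (n + 1) := by
  rw [mem_degreeLT, degree_lt_iff_coeff_zero] at hf
  have h1 : f.natDegree ≤ n := natDegree_le_iff_coeff_eq_zero.2 fun N hN => hf N hN
  rw [mem_degreeLT]
  have h2 : (f.comp F).natDegree ≤ n := by rwa [natDegree_comp, hF, mul_one]
  refine lt_of_le_of_lt (natDegree_le_iff_degree_le.1 h2) ?_
  exact_mod_cast n.lt_succ_self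

theorem degree_eq_of_mem_degreeLT {f : ℂ[X]} {n : ℕ} (hf : f ∈ degreeLT ℂ (n + 1))
    (hc : f.coeff n ≠ 0) : f.degree = n := by
  rw [mem_degreeLT, degree_lt_iff_coeff_zero] at hf
  exact le_antisymm ((degree_le_iff_coeff_zero _ _).2 fun m hm => hf m (Nat.cast_lt.1 hm))
    (le_degree_of_ne_zero hc)

theorem degree_comp_eq {f F : ℂ[X]} {n : ℕ} (hF : F.natDegree = 1) (hf : f.degree = n) :
    (f.comp F).degree = n := by
  have hn : f.natDegree = n := natDegree_eq_of_degree_eq_some hf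
  have hne : f.comp F ≠ 0 := by
    rw [Ne, comp_eq_zero_iff]
    rintro (h0 | ⟨-, h0⟩)
    · rw [h0] at hf; simp at hf
    · rw [h0] at hF; simp at hF
  rw [degree_eq_natDegree hne, natDegree_comp, hF, mul_one, hn]

/-- If `𝔻² P (n+2)` is a nonzero multiple of `R n` and `P n` is a combination of
`R (n-4), …, R n`, then `P` satisfies the second structure relation. -/
theorem secondStructureRelation_of_banded {L : Lattice} {P R : ℕ → ℂ[X]}
    (hP : ∀ n, (P n).degree = n)
    (hD : ∀ n, ∃ K : ℂ, K ≠ 0 ∧ L.D (L.D (P (n + 2))) = K • R n)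
    (hR : ∀ n, P n ∈ Submodule.span ℂ (R '' Set.Icc (n - 4) n)) :
    SecondStructureRelation L P := by
  refine secondStructureRelation_of_mem_span hP fun n _ => ?_
  refine (Submodule.span_le.2 ?_ : Submodule.span ℂ (R '' Set.Icc (n - 4) n) ≤ _) (hR n)
  rintro _ ⟨k, ⟨hk1, hk2⟩, rfl⟩
  obtain ⟨K, hK, h⟩ := hD k
  have : R k = K⁻¹ • L.D (L.D (P (k + 2))) := by
    rw [h, smul_smul, inv_mul_cancel₀ hK, one_smul]
  rw [this]
  exact Submodule.smul_mem _ _ (Submodule.subset_span ⟨k + 2, ⟨by omega, by omega⟩, rfl⟩)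

/-! ### Askey-Wilson polynomials: basis, degree and symmetry. -/

theorem qPoch_zero (a q : ℂ) : qPoch a q 0 = 1 := by simp [qPoch]

theorem qPoch_succ (a q : ℂ) (k : ℕ) : qPoch a q (k + 1) = qPoch a q k * (1 - a * q ^ k) := by
  simp [qPoch, Finset.prod_range_succ]

theorem qPoch_succ' (a q : ℂ) (k : ℕ) : qPoch a q (k + 1) = (1 - a) * qPoch (a * q) q k := by
  simp [qPoch, Finset.prod_range_succ', pow_succ', mul_assoc, mul_comm]

theorem qPoch_ne_zero {a q : ℂ} {k : ℕ} (h : ∀ j < k, a * q ^ j ≠ 1) : qPoch a q k ≠ 0 :=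
  Finset.prod_ne_zero_iff.2 fun j hj => sub_ne_zero.2 (h j (Finset.mem_range.1 hj)).symm

theorem qPoch_self_ne_zero {q : ℂ} (hq : ∀ k : ℕ, 1 ≤ k → q ^ k ≠ 1) (k : ℕ) :
    qPoch q q k ≠ 0 :=
  qPoch_ne_zero fun j _ => by rw [← pow_succ']; exact hq _ (by omega)

/-- The polynomial `(a e^(iθ), a e^(-iθ); q)_k` of `X = cos θ`. -/
def qBasis (q a : ℂ) (k : ℕ) : ℂ[X] :=
  ∏ j ∈ Finset.range k, (1 - C (2 * a * q ^ j) * X + C (a ^ 2 * q ^ (2 * j)))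

theorem qBasis_eq (q a : ℂ) (k : ℕ) : qBasis q a k =
    ∏ j ∈ Finset.range k, (C (1 + a ^ 2 * q ^ (2 * j)) + C (-(2 * a * q ^ j)) * X) :=
  Finset.prod_congr rfl fun j _ => by rw [C_neg, C_add, C_1]; ring

theorem qBasis_mem_degreeLT (q a : ℂ) (k : ℕ) : qBasis q a k ∈ degreeLT ℂ (k + 1) := by
  rw [qBasis_eq]; exact prod_linear_mem_degreeLT _ _ k

theorem qBasis_coeff_ne_zero {q a : ℂ} (hq : q ≠ 0) (ha : a ≠ 0) (k : ℕ) :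
    (qBasis q a k).coeff k ≠ 0 := by
  rw [qBasis_eq, prod_linear_coeff]
  exact Finset.prod_ne_zero_iff.2 fun j _ => by simp [hq, ha]

theorem qBasis_eval (q a : ℂ) (k : ℕ) {u : ℂ} (hu : u ≠ 0) :
    (qBasis q a k).eval ((u + u⁻¹) / 2) = qPoch (a * u) q k * qPoch (a * u⁻¹) q k := by
  rw [qBasis, eval_prod, qPoch, qPoch, ← Finset.prod_mul_distrib]
  refine Finset.prod_congr rfl fun j _ => ?_
  simp only [eval_add, eval_sub, eval_mul, eval_C, eval_X, eval_one]
  field_simp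
  ring

theorem qBasis_succ (q a : ℂ) (k : ℕ) : qBasis q a (k + 1) =
    (1 - C (2 * a) * X + C (a ^ 2)) * qBasis q (a * q) k := by
  rw [qBasis, Finset.prod_range_succ', mul_comm, qBasis]
  congr 1
  · simp
  · refine Finset.prod_congr rfl fun j _ => ?_
    rw [show 2 * a * q ^ (j + 1) = 2 * (a * q) * q ^ j by ring,
      show a ^ 2 * q ^ (2 * (j + 1)) = (a * q) ^ 2 * q ^ (2 * j) by ring]

/-- The change of basis `a → a q`. -/
theorem qBasis_succ_shift {q : ℂ} (hq : q ≠ 0) (a : ℂ) (k : ℕ) : qBasis q a (k + 1) =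
    (q ^ (k + 1))⁻¹ • qBasis q (a * q) (k + 1) +
      ((1 - (q ^ (k + 1))⁻¹) * (1 - a ^ 2 * q ^ (k + 1))) • qBasis q (a * q) k := by
  -- The first factor for `a` and the last factor for `a q` are both affine in `X`, so one is a
  -- multiple of the other plus a constant.
  have h : (1 - C (2 * a) * X + C (a ^ 2) : ℂ[X]) =
      C (q ^ (k + 1))⁻¹ * (1 - C (2 * (a * q) * q ^ k) * X + C ((a * q) ^ 2 * q ^ (2 * k))) +
      C ((1 - (q ^ (k + 1))⁻¹) * (1 - a ^ 2 * q ^ (k + 1))) := by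
    refine Polynomial.funext fun r => ?_
    simp only [eval_add, eval_sub, eval_mul, eval_C, eval_X, eval_one]
    field_simp
    ring
  rw [qBasis_succ, h, smul_eq_C_mul, smul_eq_C_mul, qBasis, qBasis, Finset.prod_range_succ]
  ring

/-- The coefficient of `qBasis q a k` in the Askey-Wilson polynomial of degree `n`. -/
def awCoeff (q a b c d : ℂ) (n k : ℕ) : ℂ :=
  (a ^ n)⁻¹ * (qPoch (a * b * q ^ k) q (n - k) * qPoch (a * c * q ^ k) q (n - k) *
        qPoch (a * d * q ^ k) q (n - k) *
        (qPoch ((q ^ n)⁻¹) q k * qPoch (a * b * c * d * q ^ ((n : ℤ) - 1)) q k /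
          qPoch q q k * q ^ k))

theorem askeyWilson_eq_sum (q a b c d : ℂ) (n : ℕ) :
    askeyWilson q a b c d n = ∑ k ∈ Finset.range (n + 1), awCoeff q a b c d n k • qBasis q a k := by
  rw [askeyWilson, Finset.mul_sum]
  refine Finset.sum_congr rfl fun k _ => ?_
  rw [smul_eq_C_mul, awCoeff, qBasis, C_mul (a := (a ^ n)⁻¹), mul_assoc (C (a ^ n)⁻¹)]

/-- The product `(q^(-n); q)_(n+1)` contains the factor `1 - q^(-n) q^n`. Thanks to this,
polynomials of degrees `n` and `n + 1` can be summed over the same range. -/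
theorem awCoeff_eq_zero {q : ℂ} (hq : q ≠ 0) (a b c d : ℂ) (n : ℕ) :
    awCoeff q a b c d n (n + 1) = 0 := by
  have : qPoch ((q ^ n)⁻¹) q (n + 1) = 0 := by
    rw [qPoch_succ, inv_mul_cancel₀ (pow_ne_zero n hq), sub_self, mul_zero]
  simp [awCoeff, this]

theorem askeyWilson_zero (q a b c d : ℂ) : askeyWilson q a b c d 0 = 1 := by
  simp [askeyWilson, qPoch]

/-- Symmetry in `b, c, d` is visible in each coefficient. The deeper symmetry involving `a` is not
used, which is why `a` gets a contiguous relation of its own. -/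
theorem askeyWilson_swap_bd (q a b c d : ℂ) : askeyWilson q a b c d = askeyWilson q a d c b := by
  funext n
  rw [askeyWilson_eq_sum, askeyWilson_eq_sum]
  refine Finset.sum_congr rfl fun k _ => ?_
  rw [awCoeff, awCoeff, show a * d * c * b = a * b * c * d by ring]
  congr 1; ring

theorem askeyWilson_swap_cd (q a b c d : ℂ) : askeyWilson q a b c d = askeyWilson q a b d c := by
  funext n
  rw [askeyWilson_eq_sum, askeyWilson_eq_sum]
  refine Finset.sum_congr rfl fun k _ => ?_
  rw [awCoeff, awCoeff, show a * b * d * c = a * b * c * d by ring]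
  congr 1; ring

theorem askeyWilson_mem_degreeLT (q a b c d : ℂ) (n : ℕ) :
    askeyWilson q a b c d n ∈ degreeLT ℂ (n + 1) := by
  rw [askeyWilson_eq_sum]
  exact Submodule.sum_mem _ fun k hk => Submodule.smul_mem _ _
    (degreeLT_mono (Finset.mem_range.1 hk) (qBasis_mem_degreeLT q a k))

theorem degree_askeyWilson {q a b c d : ℂ} (hq₀ : q ≠ 0) (hq : ∀ k : ℕ, 1 ≤ k → q ^ k ≠ 1)
    (ha : a ≠ 0) (h : ∀ m : ℕ, a * b * c * d * q ^ m ≠ 1) (n : ℕ) :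
    (askeyWilson q a b c d n).degree = n := by
  refine degree_eq_of_mem_degreeLT (askeyWilson_mem_degreeLT q a b c d n) ?_
  have hlow : ∑ k ∈ Finset.range n, awCoeff q a b c d n k • qBasis q a k ∈ degreeLT ℂ n :=
    Submodule.sum_mem _ fun k hk => Submodule.smul_mem _ _
      (degreeLT_mono (Finset.mem_range.1 hk) (qBasis_mem_degreeLT q a k))
  rw [askeyWilson_eq_sum, Finset.sum_range_succ, coeff_add, coeff_eq_zero_of_mem_degreeLT hlow,
    zero_add, coeff_smul, smul_eq_mul]
  refine mul_ne_zero ?_ (qBasis_coeff_ne_zero hq₀ ha n)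
  have h1 : qPoch ((q ^ n)⁻¹) q n ≠ 0 := qPoch_ne_zero fun j hj h0 => by
    obtain ⟨i, rfl⟩ := Nat.exists_eq_add_of_lt hj
    apply hq (i + 1) (by omega)
    rw [add_assoc, pow_add] at h0
    field_simp at h0
    exact h0.symm
  have h2 : qPoch (a * b * c * d * q ^ ((n : ℤ) - 1)) q n ≠ 0 := qPoch_ne_zero fun j hj => by
    -- A factor exists only for `n ≥ 1`, so the exponent `n - 1 + j` is a natural number, as
    -- admissibility requires.
    obtain ⟨m, rfl⟩ : ∃ m, n = m + 1 := ⟨n - 1, by omega⟩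
    have := h (m + j)
    rw [pow_add] at this
    simpa [mul_assoc] using this
  simp [awCoeff, qPoch_zero, h1, h2, qPoch_self_ne_zero hq, hq₀, ha]

/-! ### Contiguous relations for Askey-Wilson polynomials. -/

/-- Since `qBasis q a` does not involve `d`, the relation for `d ↦ d q` may be checked coefficient
by coefficient. -/
theorem awCoeff_contiguous {q a b c d : ℂ} (hq₀ : q ≠ 0) (hq : ∀ k : ℕ, 1 ≤ k → q ^ k ≠ 1)
    (ha : a ≠ 0) (h : ∀ m : ℕ, a * b * c * d * q ^ m ≠ 1) (n : ℕ) :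
    ∃ A B : ℂ, ∀ k ≤ n + 1, awCoeff q a b c d (n + 1) k =
      A * awCoeff q a b c (d * q) (n + 1) k + B * awCoeff q a b c (d * q) n k := by
  have hw : q ^ n ≠ 0 := pow_ne_zero n hq₀
  have hS1 : 1 - a * b * c * d * q ^ n ≠ 0 := sub_ne_zero.2 (h n).symm
  have hS2 : 1 - a * b * c * d * (q ^ n) ^ 2 * q ≠ 0 := by
    have := h (2 * n + 1)
    rw [pow_succ, pow_mul', ← mul_assoc] at this
    exact sub_ne_zero.2 this.symm
  have hN : q ^ n * q - 1 ≠ 0 := by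
    rw [← pow_succ]; exact sub_ne_zero.2 (hq _ (by omega))
  have hz1 : q ^ (((n + 1 : ℕ) : ℤ) - 1) = q ^ n := by simp
  have hz0 : a * b * c * (d * q) * q ^ ((n : ℤ) - 1) = a * b * c * d * q ^ n := by
    rw [zpow_sub_one₀ hq₀, zpow_natCast]; field_simp
  -- `A` is the quotient of leading coefficients (`k = n + 1`); `B` is then what `k = 0` dictates
  -- for generic parameters.
  refine ⟨(1 - a * b * c * d * q ^ n) / (1 - a * b * c * d * (q ^ n) ^ 2 * q),
    d * (q ^ n * q - 1) * (1 - b * c * q ^ n) / (1 - a * b * c * d * (q ^ n) ^ 2 * q) *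
      ((1 - a * b * q ^ n) * (1 - a * c * q ^ n)), fun k hk => ?_⟩
  have hV : qPoch (a * b * c * (d * q) * q ^ n) q k =
      qPoch (a * b * c * d * q ^ n) q k * (1 - a * b * c * d * q ^ n * q ^ k) /
        (1 - a * b * c * d * q ^ n) := by
    rw [eq_div_iff hS1, ← qPoch_succ, qPoch_succ', mul_comm]
    congr 2; ring
  rcases hk.eq_or_lt with rfl | hk
  · rw [awCoeff_eq_zero hq₀, mul_zero, add_zero, awCoeff, awCoeff, hz1, hV]
    simp only [Nat.sub_self, qPoch_zero]
    rw [show 1 - a * b * c * d * q ^ n * q ^ (n + 1) =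
      1 - a * b * c * d * (q ^ n) ^ 2 * q by ring]
    field_simp
  · obtain ⟨r, rfl⟩ := Nat.exists_eq_add_of_le (Nat.lt_succ_iff.1 hk)
    have hU : qPoch ((q ^ (k + r))⁻¹) q k = qPoch ((q ^ (k + r + 1))⁻¹) q k *
        (q ^ (k + r) * q - q ^ k) / (q ^ (k + r) * q - 1) := by
      have h1 := qPoch_succ' (q ^ (k + r + 1))⁻¹ q k
      rw [qPoch_succ, show (q ^ (k + r + 1))⁻¹ * q = (q ^ (k + r))⁻¹ by
        rw [pow_succ]; field_simp, pow_succ] at h1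
      rw [eq_div_iff hN, pow_succ]
      generalize qPoch (q ^ (k + r))⁻¹ q k = x at *
      generalize qPoch (q ^ (k + r) * q)⁻¹ q k = x' at *
      generalize q ^ (k + r) = w at *
      field_simp at h1
      linear_combination -h1
    have e (t : ℂ) : qPoch (t * q ^ k) q (r + 1) =
        qPoch (t * q ^ k) q r * (1 - t * q ^ (k + r)) := by
      rw [qPoch_succ, pow_add, mul_assoc t]
    have ed : qPoch (a * d * q ^ k) q (r + 1) =
        (1 - a * d * q ^ k) * qPoch (a * (d * q) * q ^ k) q r := by
      rw [qPoch_succ']; congr 2; ring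
    simp only [awCoeff, hz1, hz0]
    rw [show k + r + 1 - k = r + 1 by omega, show k + r - k = r by omega, hV, hU, e, e, ed, e]
    rw [show a * (d * q) * q ^ (k + r) = a * d * q ^ (k + r) * q by ring]
    -- The remaining `q`-shifted factorials are common factors. With `w = q^n` and `y = q^k` a
    -- rational identity is left; its denominators stay atomic until they are cleared.
    generalize qPoch (a * b * q ^ k) q r = x1
    generalize qPoch (a * c * q ^ k) q r = x2
    generalize qPoch (a * (d * q) * q ^ k) q r = x3
    generalize qPoch (a * b * c * d * q ^ (k + r)) q k = x4
    generalize qPoch ((q ^ (k + r + 1))⁻¹) q k = x5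
    have hQ := qPoch_self_ne_zero hq k
    generalize qPoch q q k = x6 at hQ
    rw [pow_succ a]
    have hA : a ^ (k + r) ≠ 0 := pow_ne_zero _ ha
    generalize a ^ (k + r) = x7 at hA
    generalize q ^ (k + r) = w at *
    generalize q ^ k = y at *
    clear e ed hU hV hz1 hz0 h hq
    generalize hD1 : 1 - a * b * c * d * w = D1 at *
    generalize hD2 : 1 - a * b * c * d * w ^ 2 * q = D2 at *
    generalize hD3 : w * q - 1 = D3 at *
    field_simp
    subst hD1 hD2 hD3
    ring

/-- Shifting `a` also changes the basis. The left side is the coefficient after re-expansion by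
`qBasis_succ_shift`; again `k = n + 1` gives `A` and `k = 0` gives `B`. -/
theorem awCoeff_contiguous_base {q a b c d : ℂ} (hq₀ : q ≠ 0) (hq : ∀ k : ℕ, 1 ≤ k → q ^ k ≠ 1)
    (ha : a ≠ 0) (h : ∀ m : ℕ, a * b * c * d * q ^ m ≠ 1) (n : ℕ) :
    ∃ A B : ℂ, ∀ k ≤ n + 1, awCoeff q a b c d (n + 1) k * (q ^ k)⁻¹ +
        awCoeff q a b c d (n + 1) (k + 1) *
          ((1 - (q ^ (k + 1))⁻¹) * (1 - a ^ 2 * q ^ (k + 1))) =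
      A * awCoeff q (a * q) b c d (n + 1) k + B * awCoeff q (a * q) b c d n k := by
  have hw : q ^ n ≠ 0 := pow_ne_zero n hq₀
  have hS1 : 1 - a * b * c * d * q ^ n ≠ 0 := sub_ne_zero.2 (h n).symm
  have hS2 : 1 - a * b * c * d * (q ^ n) ^ 2 * q ≠ 0 := by
    have := h (2 * n + 1)
    rw [pow_succ, pow_mul', ← mul_assoc] at this
    exact sub_ne_zero.2 this.symm
  have hN : q ^ n * q - 1 ≠ 0 := by
    rw [← pow_succ]; exact sub_ne_zero.2 (hq _ (by omega))
  have hz1 : q ^ (((n + 1 : ℕ) : ℤ) - 1) = q ^ n := by simp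
  have hz0 : a * q * b * c * d * q ^ ((n : ℤ) - 1) = a * b * c * d * q ^ n := by
    rw [zpow_sub_one₀ hq₀, zpow_natCast]; field_simp
  refine ⟨(1 - a * b * c * d * q ^ n) / (1 - a * b * c * d * (q ^ n) ^ 2 * q),
    (q ^ n * q - 1) / (a * q) * (1 / (q ^ n * q) + a * b * c * d * q ^ n + a ^ 2 * q -
      a * b - a * c - a * d - (1 - a * b * (q ^ n * q)) * (1 - a * c * (q ^ n * q)) *
        (1 - a * d * (q ^ n * q)) / (q ^ n * q) / (1 - a * b * c * d * (q ^ n) ^ 2 * q)),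
    fun k hk => ?_⟩
  have hV : qPoch (a * q * b * c * d * q ^ n) q k =
      qPoch (a * b * c * d * q ^ n) q k * (1 - a * b * c * d * q ^ n * q ^ k) /
        (1 - a * b * c * d * q ^ n) := by
    rw [eq_div_iff hS1, ← qPoch_succ, qPoch_succ', mul_comm]
    congr 2; ring
  rcases hk.eq_or_lt with rfl | hk
  · rw [awCoeff_eq_zero hq₀, awCoeff_eq_zero hq₀, mul_zero, zero_mul, add_zero, add_zero, awCoeff,
      awCoeff, hz1, hV]
    simp only [Nat.sub_self, qPoch_zero]
    rw [show 1 - a * b * c * d * q ^ n * q ^ (n + 1) =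
      1 - a * b * c * d * (q ^ n) ^ 2 * q by ring, mul_pow]
    have hQ := qPoch_self_ne_zero hq (n + 1)
    field_simp
  · obtain ⟨r, rfl⟩ := Nat.exists_eq_add_of_le (Nat.lt_succ_iff.1 hk)
    have hU : qPoch ((q ^ (k + r))⁻¹) q k = qPoch ((q ^ (k + r + 1))⁻¹) q k *
        (q ^ (k + r) * q - q ^ k) / (q ^ (k + r) * q - 1) := by
      have h1 := qPoch_succ' (q ^ (k + r + 1))⁻¹ q k
      rw [qPoch_succ, show (q ^ (k + r + 1))⁻¹ * q = (q ^ (k + r))⁻¹ by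
        rw [pow_succ]; field_simp, pow_succ] at h1
      rw [eq_div_iff hN, pow_succ]
      generalize qPoch (q ^ (k + r))⁻¹ q k = x at *
      generalize qPoch (q ^ (k + r) * q)⁻¹ q k = x' at *
      generalize q ^ (k + r) = w at *
      field_simp at h1
      linear_combination -h1
    have e (t : ℂ) : qPoch (t * q ^ k) q (r + 1) =
        (1 - t * q ^ k) * qPoch (t * q ^ (k + 1)) q r := by
      rw [qPoch_succ', pow_succ, mul_assoc t]
    have e' (t : ℂ) : qPoch (a * q * t * q ^ k) q (r + 1) =
        qPoch (a * t * q ^ (k + 1)) q r * (1 - a * t * (q ^ (k + r) * q)) := by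
      rw [qPoch_succ, show a * q * t * q ^ k = a * t * q ^ (k + 1) by ring,
        show a * t * q ^ (k + 1) * q ^ r = a * t * (q ^ (k + r) * q) by ring]
    have e'' (t : ℂ) : qPoch (a * q * t * q ^ k) q r = qPoch (a * t * q ^ (k + 1)) q r := by
      rw [show a * q * t * q ^ k = a * t * q ^ (k + 1) by ring]
    have hqk : 1 - q * q ^ k ≠ 0 := by
      rw [← pow_succ']; exact sub_ne_zero.2 (hq _ (by omega)).symm
    simp only [awCoeff, hz1, hz0]
    rw [show k + r + 1 - k = r + 1 by omega, show k + r + 1 - (k + 1) = r by omega,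
      show k + r - k = r by omega, hV, hU, e, e, e, e', e', e', e'', e'', e'',
      qPoch_succ _ q k, qPoch_succ _ q k, qPoch_succ _ q k, pow_succ (a * q) (k + r), mul_pow a q]
    generalize qPoch (a * b * q ^ (k + 1)) q r = x1
    generalize qPoch (a * c * q ^ (k + 1)) q r = x2
    generalize qPoch (a * d * q ^ (k + 1)) q r = x3
    generalize qPoch (a * b * c * d * q ^ (k + r)) q k = x4
    generalize qPoch ((q ^ (k + r + 1))⁻¹) q k = x5
    have hQ := qPoch_self_ne_zero hq k
    generalize qPoch q q k = x6 at hQ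
    rw [pow_succ q (k + r), pow_succ q k, pow_succ a (k + r)]
    have hA : a ^ (k + r) ≠ 0 := pow_ne_zero _ ha
    have hy : q ^ k ≠ 0 := pow_ne_zero _ hq₀
    generalize a ^ (k + r) = x7 at hA
    generalize q ^ (k + r) = w at *
    generalize q ^ k = y at *
    clear e e' e'' hU hV hz1 hz0 h hq
    generalize hD1 : 1 - a * b * c * d * w = D1 at *
    generalize hD2 : 1 - a * b * c * d * w ^ 2 * q = D2 at *
    generalize hD3 : w * q - 1 = D3 at *
    generalize hD4 : 1 - q * y = D4 at *
    field_simp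
    subst hD1 hD2 hD3 hD4
    ring

/-- Each basis element spreads over two neighbours, so a new coefficient collects contributions from
`k` and `k + 1`; `hf` removes the one from beyond the range. -/
theorem sum_qBasis_shift {q : ℂ} (hq₀ : q ≠ 0) (a : ℂ) (f : ℕ → ℂ) (n : ℕ)
    (hf : f (n + 1) = 0) :
    ∑ k ∈ Finset.range (n + 1), f k • qBasis q a k = ∑ k ∈ Finset.range (n + 1),
      (f k * (q ^ k)⁻¹ + f (k + 1) * ((1 - (q ^ (k + 1))⁻¹) * (1 - a ^ 2 * q ^ (k + 1)))) •
        qBasis q (a * q) k := by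
  simp only [add_smul, Finset.sum_add_distrib]
  rw [Finset.sum_range_succ', Finset.sum_range_succ'
    (fun k => (f k * (q ^ k)⁻¹) • qBasis q (a * q) k), Finset.sum_range_succ
    (fun k => (f (k + 1) * _) • qBasis q (a * q) k), hf, zero_mul, zero_smul, add_zero,
    add_right_comm, ← Finset.sum_add_distrib]
  congr 1
  · refine Finset.sum_congr rfl fun k _ => ?_
    rw [qBasis_succ_shift hq₀, smul_add, smul_smul, smul_smul]
  · simp [qBasis]

theorem mem_span_of_eq_combination {p p' : ℕ → ℂ[X]} (h0 : p 0 = p' 0)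
    (h : ∀ n, ∃ A B : ℂ, p (n + 1) = A • p' (n + 1) + B • p' n) (n : ℕ) :
    p n ∈ Submodule.span ℂ (p' '' Set.Icc (n - 1) n) := by
  cases n with
  | zero => exact Submodule.subset_span ⟨0, by simp, h0.symm⟩
  | succ n =>
    obtain ⟨A, B, e⟩ := h n
    rw [e]
    exact add_mem
      (Submodule.smul_mem _ _ (Submodule.subset_span ⟨n + 1, ⟨by omega, by omega⟩, rfl⟩))
      (Submodule.smul_mem _ _ (Submodule.subset_span ⟨n, ⟨by omega, by omega⟩, rfl⟩))

theorem askeyWilson_eq_sum_succ {q : ℂ} (hq₀ : q ≠ 0) (a b c d : ℂ) (n : ℕ) :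
    askeyWilson q a b c d n =
      ∑ k ∈ Finset.range (n + 1 + 1), awCoeff q a b c d n k • qBasis q a k := by
  rw [Finset.sum_range_succ, awCoeff_eq_zero hq₀, zero_smul, add_zero, askeyWilson_eq_sum]

theorem askeyWilson_mem_span_shift_d {q a b c d : ℂ} (hq₀ : q ≠ 0)
    (hq : ∀ k : ℕ, 1 ≤ k → q ^ k ≠ 1) (ha : a ≠ 0) (h : ∀ m : ℕ, a * b * c * d * q ^ m ≠ 1)
    (n : ℕ) : askeyWilson q a b c d n ∈
      Submodule.span ℂ (askeyWilson q a b c (d * q) '' Set.Icc (n - 1) n) := by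
  refine mem_span_of_eq_combination (by rw [askeyWilson_zero, askeyWilson_zero]) (fun n => ?_) n
  obtain ⟨A, B, hAB⟩ := awCoeff_contiguous hq₀ hq ha h n
  refine ⟨A, B, ?_⟩
  rw [askeyWilson_eq_sum, askeyWilson_eq_sum, askeyWilson_eq_sum_succ hq₀ _ _ _ _ n,
    Finset.smul_sum, Finset.smul_sum, ← Finset.sum_add_distrib]
  refine Finset.sum_congr rfl fun k hk => ?_
  rw [hAB k (Nat.lt_succ_iff.1 (Finset.mem_range.1 hk)), add_smul, mul_smul, mul_smul]

theorem askeyWilson_mem_span_shift_a {q a b c d : ℂ} (hq₀ : q ≠ 0)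
    (hq : ∀ k : ℕ, 1 ≤ k → q ^ k ≠ 1) (ha : a ≠ 0) (h : ∀ m : ℕ, a * b * c * d * q ^ m ≠ 1)
    (n : ℕ) : askeyWilson q a b c d n ∈
      Submodule.span ℂ (askeyWilson q (a * q) b c d '' Set.Icc (n - 1) n) := by
  refine mem_span_of_eq_combination (by rw [askeyWilson_zero, askeyWilson_zero]) (fun n => ?_) n
  obtain ⟨A, B, hAB⟩ := awCoeff_contiguous_base hq₀ hq ha h n
  refine ⟨A, B, ?_⟩
  rw [askeyWilson_eq_sum, askeyWilson_eq_sum, askeyWilson_eq_sum_succ hq₀ _ _ _ _ n,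
    sum_qBasis_shift hq₀ a _ _ (awCoeff_eq_zero hq₀ a b c d (n + 1)),
    Finset.smul_sum, Finset.smul_sum, ← Finset.sum_add_distrib]
  refine Finset.sum_congr rfl fun k hk => ?_
  rw [hAB k (Nat.lt_succ_iff.1 (Finset.mem_range.1 hk)), add_smul, mul_smul, mul_smul]

/-- The parameters are shifted in the order `d, c, b, a`, each shift widening the band by one. Every
shift multiplies `abcd` by `q`, so admissibility is used at `m + 1`, `m + 2`, `m + 3`. -/
theorem askeyWilson_mem_span_shift {q a b c d : ℂ} (hq₀ : q ≠ 0)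
    (hq : ∀ k : ℕ, 1 ≤ k → q ^ k ≠ 1) (ha : a ≠ 0) (h : ∀ m : ℕ, a * b * c * d * q ^ m ≠ 1)
    (n : ℕ) : askeyWilson q a b c d n ∈ Submodule.span ℂ
      (askeyWilson q (a * q) (b * q) (c * q) (d * q) '' Set.Icc (n - 4) n) := by
  have h1 := askeyWilson_mem_span_shift_d hq₀ hq ha h
  have h2 := askeyWilson_mem_span_shift_d (b := b) (c := d * q) (d := c) hq₀ hq ha
    (fun m => by convert h (m + 1) using 1; ring)
  have h3 := askeyWilson_mem_span_shift_d (b := c * q) (c := d * q) (d := b) hq₀ hq ha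
    (fun m => by convert h (m + 2) using 1; ring)
  have h4 := askeyWilson_mem_span_shift_a (b := b * q) (c := c * q) (d := d * q) hq₀ hq ha
    (fun m => by convert h (m + 3) using 1; ring)
  rw [askeyWilson_swap_cd q a b c (d * q)] at h1
  rw [askeyWilson_swap_bd q a b (d * q) (c * q), askeyWilson_swap_cd q a (c * q) (d * q) b,
    askeyWilson_swap_cd q a (c * q) b (d * q)] at h2
  rw [askeyWilson_swap_bd q a (c * q) (d * q) (b * q),
    askeyWilson_swap_cd q a (b * q) (d * q) (c * q)] at h3
  exact mem_span_Icc_trans (mem_span_Icc_trans (mem_span_Icc_trans h1 h2) h3) h4 n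

/-! ### Divided differences on the `q`-quadratic lattice. -/

theorem natDegree_affine {α : ℂ} (hα : α ≠ 0) (β : ℂ) : (C α * (X - C β)).natDegree = 1 := by
  rw [natDegree_C_mul hα, natDegree_X_sub_C]

section

variable {q c₁ c₂ c₃ κ : ℂ} {hq₀ : q ≠ 0} {hq₁ : q ≠ 1} {hc₁ : c₁ ≠ 0}

theorem ne_zero_of_sq_eq (hc₁ : c₁ ≠ 0) (hc₂ : c₂ ≠ 0) (hκ : κ ^ 2 = 4 * c₁ * c₂) : κ ≠ 0 := by
  rintro rfl
  have : 4 * c₁ * c₂ ≠ 0 := by simp [hc₁, hc₂]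
  exact this (by rw [← hκ]; simp)

theorem cpow_half_mul_self (q : ℂ) (hq₀ : q ≠ 0) :
    q ^ (1 / 2 : ℂ) * q ^ (1 / 2 : ℂ) = q := by
  rw [← Complex.cpow_add _ _ hq₀]; norm_num

theorem cpow_half_ne_zero (q : ℂ) (hq₀ : q ≠ 0) : q ^ (1 / 2 : ℂ) ≠ 0 :=
  (Complex.cpow_ne_zero_iff_of_exponent_ne_zero (by norm_num)).2 hq₀

/-- The divided difference on a `q`-quadratic lattice in the variable `u = e^(iθ)`. -/
theorem D_comp_qQuadratic (hc₂ : c₂ ≠ 0) (hκ : κ ^ 2 = 4 * c₁ * c₂) {f g : ℂ[X]}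
    (h : ∀ u : ℂ, u ≠ 0 → ∀ p : ℂ, p = q ^ (1 / 2 : ℂ) →
      g.eval ((u + u⁻¹) / 2) * (κ / 2 * ((p - p⁻¹) * (u - u⁻¹))) =
        f.eval ((u * p + (u * p)⁻¹) / 2) - f.eval ((u * p⁻¹ + (u * p⁻¹)⁻¹) / 2)) :
    (Lattice.qQuadratic q c₁ c₂ c₃ hq₀ hq₁ hc₁).D (f.comp (C κ⁻¹ * (X - C c₃))) =
      g.comp (C κ⁻¹ * (X - C c₃)) := by
  have hκ0 := ne_zero_of_sq_eq hc₁ hc₂ hκ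
  have hp0 := cpow_half_ne_zero q hq₀
  apply Lattice.D_eq_of_isDividedDifference
  intro s
  have e1 : q ^ (s + 1 / 2) = q ^ s * q ^ (1 / 2 : ℂ) := Complex.cpow_add _ _ hq₀
  have e2 : q ^ (s - 1 / 2) = q ^ s * (q ^ (1 / 2 : ℂ))⁻¹ := by
    rw [Complex.cpow_sub _ _ hq₀, div_eq_mul_inv]
  have hz : q ^ s ≠ 0 := by simp [Complex.cpow_eq_zero_iff, hq₀]
  -- With `z = q^s`, the choice `u = 2 c₂ z / κ` gives `c₂ z = κ u / 2` and, by `κ² = 4 c₁ c₂`, `c₁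
  -- / z = κ / (2 u)`. Half-steps multiply `u` by `p` or its inverse.
  have key (z : ℂ) (hz : z ≠ 0) : κ⁻¹ * (c₁ * z⁻¹ + c₂ * z + c₃ - c₃) =
      (2 * c₂ / κ * z + (2 * c₂ / κ * z)⁻¹) / 2 := by
    field_simp
    linear_combination (-1 : ℂ) * hκ
  have hu : 2 * c₂ / κ * q ^ s ≠ 0 := by simp [hc₂, hκ0, hz]
  have hh := h _ hu _ rfl
  simp only [Lattice.x, Complex.cpow_neg, e1, e2, eval_comp, eval_mul, eval_sub, eval_C, eval_X]
  rw [mul_assoc _ _ (q ^ (1 / 2 : ℂ)), mul_assoc _ _ (q ^ (1 / 2 : ℂ))⁻¹] at hh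
  rw [key _ hz, key _ (mul_ne_zero hz hp0), key _ (mul_ne_zero hz (inv_ne_zero hp0)), ← hh]
  congr 1
  generalize q ^ (1 / 2 : ℂ) = p at *
  generalize q ^ s = z at *
  field_simp
  linear_combination (p ^ 2 - 1) * hκ

/-- At `u p` and `u / p` the basis polynomial shares the factor `(a p u; q)_k (a p / u; q)_k`; only
the end factors differ, and their difference is divisible by `u - 1/u`. -/
theorem D_qBasis_comp (hc₂ : c₂ ≠ 0) (hκ : κ ^ 2 = 4 * c₁ * c₂) (a : ℂ) (k : ℕ) :
    (Lattice.qQuadratic q c₁ c₂ c₃ hq₀ hq₁ hc₁).D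
        ((qBasis q a (k + 1)).comp (C κ⁻¹ * (X - C c₃))) =
      (2 * a * (1 - q ^ (k + 1)) / (κ * (q - 1))) •
        (qBasis q (a * q ^ (1 / 2 : ℂ)) k).comp (C κ⁻¹ * (X - C c₃)) := by
  have hκ0 := ne_zero_of_sq_eq hc₁ hc₂ hκ
  rw [← smul_comp]
  refine D_comp_qQuadratic hc₂ hκ fun u hu p hp => ?_
  rw [← hp]
  have hpp : p * p = q := by rw [hp]; exact cpow_half_mul_self q hq₀
  have hp0 : p ≠ 0 := by rw [hp]; exact cpow_half_ne_zero q hq₀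
  rw [eval_smul, qBasis_eval _ _ _ hu, qBasis_eval _ _ _ (mul_ne_zero hu hp0),
    qBasis_eval _ _ _ (mul_ne_zero hu (inv_ne_zero hp0)), qPoch_succ, qPoch_succ', qPoch_succ',
    qPoch_succ]
  have e1 : a * (u * p) = a * p * u := by ring
  have e2 : a * (u * p)⁻¹ * q = a * p * u⁻¹ := by rw [← hpp]; field_simp
  have e3 : a * (u * p⁻¹) * q = a * p * u := by rw [← hpp]; field_simp
  have e4 : a * (u * p⁻¹)⁻¹ = a * p * u⁻¹ := by field_simp
  rw [e1, e2, e3, e4, smul_eq_mul]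
  have hq1 : q - 1 ≠ 0 := sub_ne_zero.2 hq₁
  generalize qPoch (a * p * u) q k = x1
  generalize qPoch (a * p * u⁻¹) q k = x2
  rw [pow_succ]
  generalize q ^ k = y
  clear hp
  subst hpp
  generalize hD : p * p - 1 = D at *
  field_simp
  subst hD
  ring

theorem D_one_comp (hc₂ : c₂ ≠ 0) (hκ : κ ^ 2 = 4 * c₁ * c₂) :
    (Lattice.qQuadratic q c₁ c₂ c₃ hq₀ hq₁ hc₁).D ((1 : ℂ[X]).comp (C κ⁻¹ * (X - C c₃))) = 0 := by
  have := D_comp_qQuadratic (c₃ := c₃) (hq₀ := hq₀) (hq₁ := hq₁) (hc₁ := hc₁) (f := 1) (g := 0)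
    hc₂ hκ (fun u hu p hp => by simp)
  simpa using this

theorem lowersDegree_qQuadratic (hc₂ : c₂ ≠ 0) (hκ : κ ^ 2 = 4 * c₁ * c₂)
    (hq : ∀ k : ℕ, 1 ≤ k → q ^ k ≠ 1) :
    (Lattice.qQuadratic q c₁ c₂ c₃ hq₀ hq₁ hc₁).LowersDegree := by
  have hκ0 := ne_zero_of_sq_eq hc₁ hc₂ hκ
  have hF := natDegree_affine (inv_ne_zero hκ0) c₃
  have hc (a : ℂ) (ha : a ≠ 0) (n : ℕ) :
      ((qBasis q a n).comp (C κ⁻¹ * (X - C c₃))).coeff n ≠ 0 :=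
    coeff_ne_zero_of_eq_degree (degree_comp_eq hF (degree_eq_of_mem_degreeLT
      (qBasis_mem_degreeLT q a n) (qBasis_coeff_ne_zero hq₀ ha n)))
  refine Lattice.lowersDegree_of_basis (fun n => (qBasis q 1 n).comp (C κ⁻¹ * (X - C c₃)))
    (fun n => comp_mem_degreeLT hF (qBasis_mem_degreeLT q 1 n)) (hc 1 one_ne_zero) fun n => ?_
  rw [D_qBasis_comp hc₂ hκ, coeff_smul, smul_eq_mul]
  refine mul_ne_zero (div_ne_zero (mul_ne_zero (by simp) ?_) (mul_ne_zero hκ0 ?_))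
    (hc _ (mul_ne_zero one_ne_zero (cpow_half_ne_zero q hq₀)) n)
  · exact sub_ne_zero.2 (hq _ (by omega)).symm
  · exact sub_ne_zero.2 hq₁

/-- Because `(a p)(b p) = a b q`, raising `k` has the same effect on the factors in `ab, ac, ad` as
rescaling all parameters. The factor `1 - q ^ (k + 1)` is the one produced by `D_qBasis_comp`. -/
theorem awCoeff_succ_succ {p a b c d : ℂ} (hq₀ : q ≠ 0) (hq : ∀ k : ℕ, 1 ≤ k → q ^ k ≠ 1)
    (ha : a ≠ 0) (hpp : p * p = q) (n k : ℕ) :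
    awCoeff q a b c d (n + 1) (k + 1) * (1 - q ^ (k + 1)) =
      a⁻¹ * p ^ n * q * (1 - (q ^ (n + 1))⁻¹) * (1 - a * b * c * d * q ^ n) *
        awCoeff q (a * p) (b * p) (c * p) (d * p) n k := by
  have hp0 : p ≠ 0 := by rintro rfl; exact hq₀ (by simpa using hpp.symm)
  have hz1 : q ^ (((n + 1 : ℕ) : ℤ) - 1) = q ^ n := by simp
  have hz0 : a * p * (b * p) * (c * p) * (d * p) * q ^ ((n : ℤ) - 1) =
      a * b * c * d * q ^ n * q := by
    rw [zpow_sub_one₀ hq₀, zpow_natCast, ← hpp]; field_simp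
  have e (t : ℂ) : a * p * (t * p) * q ^ k = a * t * q ^ (k + 1) := by rw [pow_succ, ← hpp]; ring
  have h1 : (q ^ (n + 1))⁻¹ * q = (q ^ n)⁻¹ := by rw [pow_succ]; field_simp
  have hqk : 1 - q * q ^ k ≠ 0 := by
    rw [← pow_succ']; exact sub_ne_zero.2 (hq _ (by omega)).symm
  have hQ := qPoch_self_ne_zero hq k
  simp only [awCoeff, hz0, hz1, e]
  rw [show n + 1 - (k + 1) = n - k by omega, qPoch_succ' _ q k, qPoch_succ' _ q k, h1,
    qPoch_succ q q k, mul_pow, pow_succ a n, pow_succ q k, mul_comm (q ^ k) q]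
  have hA := pow_ne_zero n ha
  have hP := pow_ne_zero n hp0
  field_simp

theorem D_askeyWilson_comp {a b c d : ℂ} (hc₂ : c₂ ≠ 0) (hκ : κ ^ 2 = 4 * c₁ * c₂)
    (hq : ∀ k : ℕ, 1 ≤ k → q ^ k ≠ 1) (ha : a ≠ 0)
    (h : ∀ m : ℕ, a * b * c * d * q ^ m ≠ 1) (n : ℕ) : ∃ K : ℂ, K ≠ 0 ∧
      (Lattice.qQuadratic q c₁ c₂ c₃ hq₀ hq₁ hc₁).D
          ((askeyWilson q a b c d (n + 1)).comp (C κ⁻¹ * (X - C c₃))) =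
        K • (askeyWilson q (a * q ^ (1 / 2 : ℂ)) (b * q ^ (1 / 2 : ℂ)) (c * q ^ (1 / 2 : ℂ))
          (d * q ^ (1 / 2 : ℂ)) n).comp (C κ⁻¹ * (X - C c₃)) := by
  have hκ0 := ne_zero_of_sq_eq hc₁ hc₂ hκ
  have hpp := cpow_half_mul_self q hq₀
  have hp0 := cpow_half_ne_zero q hq₀
  have hq1 : q - 1 ≠ 0 := sub_ne_zero.2 hq₁
  refine ⟨2 * a / (κ * (q - 1)) * (a⁻¹ * (q ^ (1 / 2 : ℂ)) ^ n * q * (1 - (q ^ (n + 1))⁻¹) *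
    (1 - a * b * c * d * q ^ n)), ?_, ?_⟩
  · have h2 : 1 - (q ^ (n + 1))⁻¹ ≠ 0 := by
      rw [sub_ne_zero, Ne, eq_comm, inv_eq_one]; exact hq _ (by omega)
    have h3 : 1 - a * b * c * d * q ^ n ≠ 0 := sub_ne_zero.2 (h n).symm
    have h4 := pow_ne_zero n hp0
    exact mul_ne_zero (div_ne_zero (mul_ne_zero two_ne_zero ha) (mul_ne_zero hκ0 hq1))
      (mul_ne_zero (mul_ne_zero (mul_ne_zero (mul_ne_zero (inv_ne_zero ha) h4) hq₀) h2) h3)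
  · rw [askeyWilson_eq_sum, askeyWilson_eq_sum, Finset.sum_range_succ', ← compLin_apply,
      ← compLin_apply, map_add, map_sum, map_sum, ← Lattice.DLin_apply, map_add, map_sum,
      Finset.smul_sum]
    have h0 : Lattice.DLin (.qQuadratic q c₁ c₂ c₃ hq₀ hq₁ hc₁)
        (compLin (C κ⁻¹ * (X - C c₃)) (awCoeff q a b c d (n + 1) 0 • qBasis q a 0)) = 0 := by
      rw [map_smul, map_smul, show qBasis q a 0 = 1 by simp [qBasis], compLin_apply,
        Lattice.DLin_apply, D_one_comp hc₂ hκ, smul_zero]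
    rw [h0, add_zero]
    refine Finset.sum_congr rfl fun k _ => ?_
    rw [map_smul, map_smul, map_smul, compLin_apply, compLin_apply, Lattice.DLin_apply,
      D_qBasis_comp hc₂ hκ, smul_smul, smul_smul]
    congr 1
    have := awCoeff_succ_succ (b := b) (c := c) (d := d) hq₀ hq ha hpp n k
    rw [mul_assoc (2 * a / (κ * (q - 1))), ← this]
    field_simp

theorem secondStructureRelation_askeyWilson {a b c d : ℂ} (hc₂ : c₂ ≠ 0) (hκ : κ ^ 2 = 4 * c₁ * c₂)
    (hq : ∀ k : ℕ, 1 ≤ k → q ^ k ≠ 1)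
    (ha : a ≠ 0) (h : ∀ m : ℕ, a * b * c * d * q ^ m ≠ 1) :
    SecondStructureRelation (Lattice.qQuadratic q c₁ c₂ c₃ hq₀ hq₁ hc₁)
      (fun n => (askeyWilson q a b c d n).comp (C κ⁻¹ * (X - C c₃))) := by
  have hκ0 := ne_zero_of_sq_eq hc₁ hc₂ hκ
  have hF := natDegree_affine (inv_ne_zero hκ0) c₃
  have hp0 := cpow_half_ne_zero q hq₀
  have hpp := cpow_half_mul_self q hq₀
  refine secondStructureRelation_of_banded
    (R := fun n => (askeyWilson q (a * q) (b * q) (c * q) (d * q) n).comp (C κ⁻¹ * (X - C c₃)))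
    (fun n => degree_comp_eq hF (degree_askeyWilson hq₀ hq ha h n)) (fun n => ?_) (fun n => ?_)
  · obtain ⟨K, hK, e⟩ := D_askeyWilson_comp (c₃ := c₃) (hq₀ := hq₀) (hq₁ := hq₁) (hc₁ := hc₁)
      hc₂ hκ hq ha h (n + 1)
    obtain ⟨K', hK', e'⟩ := D_askeyWilson_comp (c₃ := c₃) (hq₀ := hq₀) (hq₁ := hq₁) (hc₁ := hc₁)
      (a := a * q ^ (1 / 2 : ℂ)) (b := b * q ^ (1 / 2 : ℂ)) (c := c * q ^ (1 / 2 : ℂ))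
      -- The four half-steps multiply `abcd` by `q²`.
      (d := d * q ^ (1 / 2 : ℂ)) hc₂ hκ hq (mul_ne_zero ha hp0) (fun m => by
        convert h (m + 2) using 1
        generalize q ^ (1 / 2 : ℂ) = p at *
        rw [← hpp]; ring) n
    refine ⟨K * K', mul_ne_zero hK hK', ?_⟩
    rw [e, ← Lattice.DLin_apply, map_smul, Lattice.DLin_apply, e', smul_smul]
    simp only [mul_assoc, hpp]
  · have := Submodule.mem_map_of_mem (f := compLin (C κ⁻¹ * (X - C c₃)))
      (askeyWilson_mem_span_shift hq₀ hq ha h n)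
    rwa [Submodule.map_span, ← Set.image_comp] at this

end

/-! ### Continuous `q`-Hermite polynomials. -/

theorem chebyshevT_eval (n : ℤ) {u : ℂ} (hu : u ≠ 0) :
    2 * (Chebyshev.T ℂ n).eval ((u + u⁻¹) / 2) = u ^ n + u ^ (-n) := by
  have key (m : ℕ) : 2 * (Chebyshev.T ℂ (m : ℤ)).eval ((u + u⁻¹) / 2) = u ^ m + (u ^ m)⁻¹ := by
    induction m using Nat.twoStepInduction with
    | zero => simp; norm_num
    | one => simp; ring
    | more m h0 h1 =>
      have e : ((m + 2 : ℕ) : ℤ) = (m : ℤ) + 2 := by push_cast; ring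
      have e1 : ((m + 1 : ℕ) : ℤ) = (m : ℤ) + 1 := by push_cast; ring
      rw [e1] at h1
      rw [e, Chebyshev.T_add_two]
      simp only [eval_sub, eval_mul, eval_ofNat, eval_X]
      have : 2 * (2 * ((u + u⁻¹) / 2) * eval ((u + u⁻¹) / 2) (Chebyshev.T ℂ (↑m + 1)) -
          eval ((u + u⁻¹) / 2) (Chebyshev.T ℂ ↑m)) =
          (u + u⁻¹) * (2 * eval ((u + u⁻¹) / 2) (Chebyshev.T ℂ (↑m + 1))) -
          2 * eval ((u + u⁻¹) / 2) (Chebyshev.T ℂ ↑m) := by ring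
      rw [this, h0, h1]
      field_simp
      ring
  rcases Int.eq_nat_or_neg n with ⟨m, rfl | rfl⟩
  · rw [key, zpow_neg, zpow_natCast]
  · rw [Chebyshev.T_neg, key, neg_neg, zpow_neg, zpow_natCast, add_comm]

/-- The `q`-binomial coefficient. -/
def qBinom (q : ℂ) (n k : ℕ) : ℂ := qPoch q q n / (qPoch q q k * qPoch q q (n - k))

theorem qBinom_symm (q : ℂ) {n k : ℕ} (hk : k ≤ n) : qBinom q n (n - k) = qBinom q n k := by
  rw [qBinom, qBinom, Nat.sub_sub_self hk, mul_comm (qPoch q q (n - k))]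

theorem qBinom_succ_succ_mul {q : ℂ} (hq : ∀ k : ℕ, 1 ≤ k → q ^ k ≠ 1) (n k : ℕ) :
    qBinom q (n + 1) (k + 1) * (1 - q ^ (k + 1)) = (1 - q ^ (n + 1)) * qBinom q n k := by
  have h1 := qPoch_self_ne_zero hq k
  have h2 := qPoch_self_ne_zero hq (n - k)
  have h3 : 1 - q ^ (k + 1) ≠ 0 := sub_ne_zero.2 (hq _ (by omega)).symm
  rw [qBinom, qBinom, show n + 1 - (k + 1) = n - k by omega, qPoch_succ, qPoch_succ,
    ← pow_succ', ← pow_succ']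
  field_simp

theorem qBinom_succ_mul {q : ℂ} (hq : ∀ k : ℕ, 1 ≤ k → q ^ k ≠ 1) {n k : ℕ} (hk : k ≤ n) :
    qBinom q (n + 1) k * (1 - q ^ (n + 1 - k)) = (1 - q ^ (n + 1)) * qBinom q n k := by
  rw [← qBinom_symm q (by omega : k ≤ n + 1), ← qBinom_symm q hk,
    show n + 1 - k = n - k + 1 by omega, qBinom_succ_succ_mul hq]

/-- The continuous `q`-Hermite polynomial as a Laurent polynomial in `u = e^(iθ)`. -/
theorem qHermite_eval (q : ℂ) (n : ℕ) {u : ℂ} (hu : u ≠ 0) :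
    (qHermite q n).eval ((u + u⁻¹) / 2) =
      ∑ k ∈ Finset.range (n + 1), qBinom q n k * u ^ ((n : ℤ) - 2 * k) := by
  have h2 : 2 * (qHermite q n).eval ((u + u⁻¹) / 2) =
      ∑ k ∈ Finset.range (n + 1), qBinom q n k * u ^ ((n : ℤ) - 2 * k) +
      ∑ k ∈ Finset.range (n + 1), qBinom q n k * u ^ (-((n : ℤ) - 2 * k)) := by
    rw [qHermite, eval_finsetSum, Finset.mul_sum, ← Finset.sum_add_distrib]
    refine Finset.sum_congr rfl fun k _ => ?_
    rw [eval_mul, eval_C, mul_left_comm, chebyshevT_eval _ hu, mul_add, qBinom]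
  -- The reflection `k ↦ n - k` fixes the `q`-binomial coefficient and negates the exponent.
  have h3 : ∑ k ∈ Finset.range (n + 1), qBinom q n k * u ^ (-((n : ℤ) - 2 * k)) =
      ∑ k ∈ Finset.range (n + 1), qBinom q n k * u ^ ((n : ℤ) - 2 * k) := by
    rw [← Finset.sum_range_reflect]
    refine Finset.sum_congr rfl fun k hk => ?_
    have hk' : k ≤ n := Nat.lt_succ_iff.1 (Finset.mem_range.1 hk)
    rw [show n + 1 - 1 - k = n - k by omega, qBinom_symm q hk', Nat.cast_sub hk']
    congr 2; ring
  rw [h3] at h2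
  linear_combination (1 / 2) * h2

theorem qHermite_zero (q : ℂ) : qHermite q 0 = 1 := by
  simp [qHermite, qPoch]

theorem qHermite_mem_degreeLT (q : ℂ) (n : ℕ) : qHermite q n ∈ degreeLT ℂ (n + 1) := by
  refine Submodule.sum_mem _ fun k hk => ?_
  have hk' := Finset.mem_range.1 hk
  rw [← smul_eq_C_mul]
  refine Submodule.smul_mem _ _ ?_
  rw [mem_degreeLT, Chebyshev.degree_T]
  exact_mod_cast (by omega : ((n : ℤ) - 2 * (k : ℤ)).natAbs < n + 1)

theorem D_qHermite_comp {q c₁ c₂ c₃ κ : ℂ} {hq₀ : q ≠ 0} {hq₁ : q ≠ 1} {hc₁ : c₁ ≠ 0}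
    (hc₂ : c₂ ≠ 0) (hκ : κ ^ 2 = 4 * c₁ * c₂) (hq : ∀ k : ℕ, 1 ≤ k → q ^ k ≠ 1) (n : ℕ) :
    ∃ K : ℂ, K ≠ 0 ∧
      (Lattice.qQuadratic q c₁ c₂ c₃ hq₀ hq₁ hc₁).D
          ((qHermite q (n + 1)).comp (C κ⁻¹ * (X - C c₃))) =
        K • (qHermite q n).comp (C κ⁻¹ * (X - C c₃)) := by
  have hκ0 := ne_zero_of_sq_eq hc₁ hc₂ hκ
  have hq1 : q - 1 ≠ 0 := sub_ne_zero.2 hq₁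
  have hn : 1 - q ^ (n + 1) ≠ 0 := sub_ne_zero.2 (hq _ (by omega)).symm
  refine ⟨-(2 * ((q ^ (1 / 2 : ℂ)) ^ n)⁻¹ * (1 - q ^ (n + 1)) / (κ * (q - 1))), ?_, ?_⟩
  · have h4 := pow_ne_zero n (cpow_half_ne_zero q hq₀)
    exact neg_ne_zero.2 (div_ne_zero (mul_ne_zero (mul_ne_zero two_ne_zero (inv_ne_zero h4)) hn)
      (mul_ne_zero hκ0 hq1))
  rw [← smul_comp]
  refine D_comp_qQuadratic hc₂ hκ fun u hu p hp => ?_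
  rw [← hp]
  have hpp : p * p = q := by rw [hp]; exact cpow_half_mul_self q hq₀
  have hp0 : p ≠ 0 := by rw [hp]; exact cpow_half_ne_zero q hq₀
  rw [eval_smul, qHermite_eval _ _ hu, qHermite_eval _ _ (mul_ne_zero hu hp0),
    qHermite_eval _ _ (mul_ne_zero hu (inv_ne_zero hp0)), ← Finset.sum_sub_distrib]
  -- With `r = n + 1 - k`, `p^(r-k) - p^(k-r) = p^(-(n+1)) ((1 - q^k) - (1 - q^r))`. The two parts
  -- become `u⁻¹` and `u` times `H_n` by the `q`-binomial recurrences, and `u - u⁻¹` cancels.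
  have term (k : ℕ) (hk : k ≤ n + 1) :
      qBinom q (n + 1) k * (u * p) ^ (((n + 1 : ℕ) : ℤ) - 2 * k) -
        qBinom q (n + 1) k * (u * p⁻¹) ^ (((n + 1 : ℕ) : ℤ) - 2 * k) =
      (p ^ (n + 1))⁻¹ * (qBinom q (n + 1) k * (1 - q ^ k) * u ^ (((n + 1 : ℕ) : ℤ) - 2 * k) -
        qBinom q (n + 1) k * (1 - q ^ (n + 1 - k)) * u ^ (((n + 1 : ℕ) : ℤ) - 2 * k)) := by
    obtain ⟨r, hr⟩ := Nat.exists_eq_add_of_le hk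
    rw [hr, show k + r - k = r by omega, show (((k + r : ℕ) : ℤ) - 2 * k) = (r : ℤ) - k by
      push_cast; ring, mul_zpow, mul_zpow, inv_zpow', zpow_sub₀ hp0, neg_sub, zpow_sub₀ hp0,
      ← hpp, zpow_natCast, zpow_natCast]
    field_simp
    ring
  rw [Finset.sum_congr rfl fun k hk => term k (Nat.lt_succ_iff.1 (Finset.mem_range.1 hk)),
    ← Finset.mul_sum, Finset.sum_sub_distrib, Finset.sum_range_succ'
    (fun k => qBinom q (n + 1) k * (1 - q ^ k) * u ^ (((n + 1 : ℕ) : ℤ) - 2 * k)),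
    Finset.sum_range_succ
    (fun k => qBinom q (n + 1) k * (1 - q ^ (n + 1 - k)) * u ^ (((n + 1 : ℕ) : ℤ) - 2 * k))]
  have s1 : ∑ k ∈ Finset.range (n + 1), qBinom q (n + 1) (k + 1) * (1 - q ^ (k + 1)) *
      u ^ (((n + 1 : ℕ) : ℤ) - 2 * ((k + 1 : ℕ) : ℤ)) = (1 - q ^ (n + 1)) * u⁻¹ *
      ∑ k ∈ Finset.range (n + 1), qBinom q n k * u ^ ((n : ℤ) - 2 * k) := by
    rw [Finset.mul_sum]
    refine Finset.sum_congr rfl fun k _ => ?_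
    rw [qBinom_succ_succ_mul hq, show ((n + 1 : ℕ) : ℤ) - 2 * ((k + 1 : ℕ) : ℤ) =
      (n : ℤ) - 2 * k - 1 by push_cast; ring, zpow_sub_one₀ hu]
    ring
  have s2 : ∑ k ∈ Finset.range (n + 1), qBinom q (n + 1) k * (1 - q ^ (n + 1 - k)) *
      u ^ (((n + 1 : ℕ) : ℤ) - 2 * (k : ℤ)) = (1 - q ^ (n + 1)) * u *
      ∑ k ∈ Finset.range (n + 1), qBinom q n k * u ^ ((n : ℤ) - 2 * k) := by
    rw [Finset.mul_sum]
    refine Finset.sum_congr rfl fun k hk => ?_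
    rw [qBinom_succ_mul hq (Nat.lt_succ_iff.1 (Finset.mem_range.1 hk)),
      show ((n + 1 : ℕ) : ℤ) - 2 * (k : ℤ) = (n : ℤ) - 2 * k + 1 by push_cast; ring,
      zpow_add_one₀ hu]
    ring
  rw [s1, s2]
  generalize ∑ k ∈ Finset.range (n + 1), qBinom q n k * u ^ ((n : ℤ) - 2 * k) = s
  simp only [Nat.sub_self, pow_zero, sub_self, mul_zero, zero_mul, add_zero, smul_eq_mul]
  rw [pow_succ p]
  have hP := pow_ne_zero n hp0
  generalize p ^ n = y at *
  generalize 1 - q ^ (n + 1) = z at *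
  clear hp term s1 s2 hn
  subst hpp
  generalize hD : p * p - 1 = D at *
  field_simp
  subst hD
  ring

theorem secondStructureRelation_qHermite {q c₁ c₂ c₃ κ : ℂ} {hq₀ : q ≠ 0} {hq₁ : q ≠ 1}
    {hc₁ : c₁ ≠ 0} (hc₂ : c₂ ≠ 0) (hκ : κ ^ 2 = 4 * c₁ * c₂)
    (hq : ∀ k : ℕ, 1 ≤ k → q ^ k ≠ 1) :
    SecondStructureRelation (Lattice.qQuadratic q c₁ c₂ c₃ hq₀ hq₁ hc₁)
      (fun n => (qHermite q n).comp (C κ⁻¹ * (X - C c₃))) := by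
  have hκ0 := ne_zero_of_sq_eq hc₁ hc₂ hκ
  have hF := natDegree_affine (inv_ne_zero hκ0) c₃
  have hmem (n : ℕ) := comp_mem_degreeLT hF (qHermite_mem_degreeLT q n)
  -- A drop in degree at `n + 1` would pass through `𝔻` to degree `n`, contradicting the induction
  -- hypothesis.
  have hdeg (n : ℕ) : ((qHermite q n).comp (C κ⁻¹ * (X - C c₃))).coeff n ≠ 0 := by
    induction n with
    | zero => simp [qHermite_zero]
    | succ n ih =>
      intro h0
      obtain ⟨K, hK, e⟩ := D_qHermite_comp (c₃ := c₃) (hq₀ := hq₀) (hq₁ := hq₁) (hc₁ := hc₁)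
        hc₂ hκ hq n
      have h1 := coeff_eq_zero_of_mem_degreeLT
        ((Lattice.qQuadratic q c₁ c₂ c₃ hq₀ hq₁ hc₁).D_mem_degreeLT
          (mem_degreeLT_of_coeff_eq_zero (hmem (n + 1)) h0))
      rw [e, coeff_smul, smul_eq_mul] at h1
      exact mul_ne_zero hK ih h1
  refine secondStructureRelation_of_banded
    (R := fun n => (qHermite q n).comp (C κ⁻¹ * (X - C c₃)))
    (fun n => degree_eq_of_mem_degreeLT (hmem n) (hdeg n)) (fun n => ?_)
    (fun n => Submodule.subset_span ⟨n, ⟨by omega, le_rfl⟩, rfl⟩)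
  obtain ⟨K, hK, e⟩ := D_qHermite_comp (c₃ := c₃) (hq₀ := hq₀) (hq₁ := hq₁) (hc₁ := hc₁)
    hc₂ hκ hq (n + 1)
  obtain ⟨K', hK', e'⟩ := D_qHermite_comp (c₃ := c₃) (hq₀ := hq₀) (hq₁ := hq₁) (hc₁ := hc₁)
    hc₂ hκ hq n
  exact ⟨K * K', mul_ne_zero hK hK', by
    rw [e, ← Lattice.DLin_apply, map_smul, Lattice.DLin_apply, e', smul_smul]⟩

theorem secondStructureRelation_of_askeyWilsonClass {q c₁ c₂ c₃ κ : ℂ} {hq₀ : q ≠ 0}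
    {hq₁ : q ≠ 1} {hc₁ : c₁ ≠ 0} (hc₂ : c₂ ≠ 0) (hκ : κ ^ 2 = 4 * c₁ * c₂)
    (hq : ∀ k : ℕ, 1 ≤ k → q ^ k ≠ 1) {P : ℕ → ℂ[X]} (hP : AskeyWilsonClass q P) :
    SecondStructureRelation (Lattice.qQuadratic q c₁ c₂ c₃ hq₀ hq₁ hc₁)
      (fun n => (P n).comp (C κ⁻¹ * (X - C c₃))) := by
  cases hP with
  | askeyWilson a b c d ha h => exact secondStructureRelation_askeyWilson hc₂ hκ hq ha h
  | qHermite => exact secondStructureRelation_qHermite hc₂ hκ hq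
  | limit a b c d ha h _ _ _ _ _ hQ =>
    have hκ0 := ne_zero_of_sq_eq hc₁ hc₂ hκ
    have hF := natDegree_affine (inv_ne_zero hκ0) c₃
    have hm (i n : ℕ) := askeyWilson_mem_degreeLT q (a i) (b i) (c i) (d i) n
    exact .of_isLimitFamily (lowersDegree_qQuadratic hc₂ hκ hq) (hQ.comp hm hF)
      (fun i n => comp_mem_degreeLT hF (hm i n))
      fun i => secondStructureRelation_askeyWilson hc₂ hκ hq (ha i) (h i)

/-! ### Wilson polynomials: basis, degree and contiguous relations. -/

theorem poch_zero (a : ℂ) : poch a 0 = 1 := by simp [poch]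

theorem poch_succ (a : ℂ) (k : ℕ) : poch a (k + 1) = poch a k * (a + k) := by
  simp [poch, Finset.prod_range_succ]

theorem poch_succ' (a : ℂ) (k : ℕ) : poch a (k + 1) = a * poch (a + 1) k := by
  rw [poch, poch, Finset.prod_range_succ', Nat.cast_zero, add_zero, mul_comm]
  congr 1
  refine Finset.prod_congr rfl fun j _ => ?_
  push_cast; ring

theorem poch_ne_zero {a : ℂ} {k : ℕ} (h : ∀ j < k, a + j ≠ 0) : poch a k ≠ 0 :=
  Finset.prod_ne_zero_iff.2 fun j hj => h j (Finset.mem_range.1 hj)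

/-- The polynomial `(a - it)_k (a + it)_k` of `X = t²`. -/
def wilsonBasis (a : ℂ) (k : ℕ) : ℂ[X] := ∏ j ∈ Finset.range k, (C ((a + j) ^ 2) + X)

theorem wilsonBasis_eq (a : ℂ) (k : ℕ) :
    wilsonBasis a k = ∏ j ∈ Finset.range k, (C ((a + j) ^ 2) + C 1 * X) := by
  simp [wilsonBasis]

theorem wilsonBasis_mem_degreeLT (a : ℂ) (k : ℕ) : wilsonBasis a k ∈ degreeLT ℂ (k + 1) := by
  rw [wilsonBasis_eq]
  exact prod_linear_mem_degreeLT (fun j => (a + j) ^ 2) (fun _ => 1) k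

theorem wilsonBasis_coeff (a : ℂ) (k : ℕ) : (wilsonBasis a k).coeff k = 1 := by
  rw [wilsonBasis_eq, prod_linear_coeff (fun j => (a + j) ^ 2) (fun _ => 1) k]
  simp

theorem wilsonBasis_eval (a σ : ℂ) (k : ℕ) :
    (wilsonBasis a k).eval (-σ ^ 2) = poch (a + σ) k * poch (a - σ) k := by
  rw [wilsonBasis, eval_prod, poch, poch, ← Finset.prod_mul_distrib]
  refine Finset.prod_congr rfl fun j _ => ?_
  simp only [eval_add, eval_C, eval_X]
  ring

/-- The change of basis `a → a + 1`. -/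
theorem wilsonBasis_succ_shift (a : ℂ) (k : ℕ) : wilsonBasis a (k + 1) =
    wilsonBasis (a + 1) (k + 1) + (-((k + 1) * (2 * a + k + 1))) • wilsonBasis (a + 1) k := by
  have h0 : wilsonBasis a (k + 1) = wilsonBasis (a + 1) k * (C (a ^ 2) + X) := by
    rw [wilsonBasis, Finset.prod_range_succ', wilsonBasis]
    congr 1
    · refine Finset.prod_congr rfl fun j _ => ?_
      rw [show (a + ((j + 1 : ℕ) : ℂ)) ^ 2 = (a + 1 + j) ^ 2 by push_cast; ring]
    · simp
  have h1 : wilsonBasis (a + 1) (k + 1) = wilsonBasis (a + 1) k * (C ((a + 1 + k) ^ 2) + X) := by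
    rw [wilsonBasis, Finset.prod_range_succ, wilsonBasis]
  have h2 : C (a ^ 2) = C ((a + 1 + k) ^ 2) + C (-((k + 1) * (2 * a + k + 1))) := by
    rw [← C_add]; congr 1; ring
  rw [h0, h1, h2, smul_eq_C_mul]
  ring

/-- The coefficient of `wilsonBasis a k` in the Wilson polynomial of degree `n`. -/
def wilsonCoeff (a b c d : ℂ) (n k : ℕ) : ℂ :=
  poch (a + b + k) (n - k) * poch (a + c + k) (n - k) * poch (a + d + k) (n - k) *
    (poch (-(n : ℂ)) k * poch (n + a + b + c + d - 1) k / (k.factorial : ℂ))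

theorem wilson_eq_sum (a b c d : ℂ) (n : ℕ) :
    wilson a b c d n = ∑ k ∈ Finset.range (n + 1), wilsonCoeff a b c d n k • wilsonBasis a k :=
  Finset.sum_congr rfl fun k _ => by rw [smul_eq_C_mul, wilsonCoeff, wilsonBasis]

theorem wilsonCoeff_eq_zero (a b c d : ℂ) (n : ℕ) : wilsonCoeff a b c d n (n + 1) = 0 := by
  have : poch (-(n : ℂ)) (n + 1) = 0 := by rw [poch_succ, neg_add_cancel, mul_zero]
  simp [wilsonCoeff, this]

theorem wilson_eq_sum_succ (a b c d : ℂ) (n : ℕ) : wilson a b c d n =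
    ∑ k ∈ Finset.range (n + 1 + 1), wilsonCoeff a b c d n k • wilsonBasis a k := by
  rw [Finset.sum_range_succ, wilsonCoeff_eq_zero, zero_smul, add_zero, wilson_eq_sum]

theorem wilson_zero (a b c d : ℂ) : wilson a b c d 0 = 1 := by
  simp [wilson, poch]

theorem wilson_swap_bd (a b c d : ℂ) : wilson a b c d = wilson a d c b := by
  funext n
  rw [wilson_eq_sum, wilson_eq_sum]
  refine Finset.sum_congr rfl fun k _ => ?_
  rw [wilsonCoeff, wilsonCoeff, show n + a + d + c + b - 1 = n + a + b + c + d - 1 by ring]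
  congr 1; ring

theorem wilson_swap_cd (a b c d : ℂ) : wilson a b c d = wilson a b d c := by
  funext n
  rw [wilson_eq_sum, wilson_eq_sum]
  refine Finset.sum_congr rfl fun k _ => ?_
  rw [wilsonCoeff, wilsonCoeff, show n + a + b + d + c - 1 = n + a + b + c + d - 1 by ring]
  congr 1; ring

theorem wilson_mem_degreeLT (a b c d : ℂ) (n : ℕ) : wilson a b c d n ∈ degreeLT ℂ (n + 1) := by
  rw [wilson_eq_sum]
  exact Submodule.sum_mem _ fun k hk => Submodule.smul_mem _ _
    (degreeLT_mono (Finset.mem_range.1 hk) (wilsonBasis_mem_degreeLT a k))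

theorem coeff_sum_wilsonBasis (f : ℕ → ℂ) (a : ℂ) (n : ℕ) :
    (∑ k ∈ Finset.range (n + 1), f k • wilsonBasis a k).coeff n = f n := by
  have hlow : ∑ k ∈ Finset.range n, f k • wilsonBasis a k ∈ degreeLT ℂ n :=
    Submodule.sum_mem _ fun k hk => Submodule.smul_mem _ _
      (degreeLT_mono (Finset.mem_range.1 hk) (wilsonBasis_mem_degreeLT a k))
  rw [Finset.sum_range_succ, coeff_add, coeff_eq_zero_of_mem_degreeLT hlow,
    zero_add, coeff_smul, smul_eq_mul, wilsonBasis_coeff, mul_one]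

theorem poch_neg_ne_zero (n : ℕ) : poch (-(n : ℂ)) n ≠ 0 := poch_ne_zero fun j hj h0 => by
  rw [neg_add_eq_zero, Nat.cast_inj] at h0
  omega

theorem degree_wilson {a b c d : ℂ} (h : ∀ m : ℕ, a + b + c + d + m ≠ 0) (n : ℕ) :
    (wilson a b c d n).degree = n := by
  refine degree_eq_of_mem_degreeLT (wilson_mem_degreeLT a b c d n) ?_
  rw [wilson_eq_sum, coeff_sum_wilsonBasis]
  have h2 : poch (n + a + b + c + d - 1) n ≠ 0 := poch_ne_zero fun j hj => by
    obtain ⟨m, rfl⟩ : ∃ m, n = m + 1 := ⟨n - 1, by omega⟩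
    convert h (m + j) using 1
    push_cast; ring
  simp [wilsonCoeff, poch_zero, poch_neg_ne_zero, h2, Nat.factorial_ne_zero]

theorem poch_neg_eq (n k : ℕ) : poch (-(n : ℂ)) k =
    poch (-((n + 1 : ℕ) : ℂ)) k * (n + 1 - k) / (n + 1) := by
  have h1 : (n : ℂ) + 1 ≠ 0 := by exact_mod_cast n.succ_ne_zero
  have h := poch_succ' (-((n + 1 : ℕ) : ℂ)) k
  rw [poch_succ, show -((n + 1 : ℕ) : ℂ) + 1 = -(n : ℂ) by push_cast; ring] at h
  rw [eq_div_iff h1]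
  push_cast at h ⊢
  linear_combination h

theorem wilsonCoeff_contiguous {a b c d : ℂ} (h : ∀ m : ℕ, a + b + c + d + m ≠ 0) (n : ℕ) :
    ∃ A B : ℂ, ∀ k ≤ n + 1, wilsonCoeff a b c d (n + 1) k =
      A * wilsonCoeff a b c (d + 1) (n + 1) k + B * wilsonCoeff a b c (d + 1) n k := by
  have hS1 : a + b + c + d + n ≠ 0 := h n
  have hS2 : a + b + c + d + 2 * n + 1 ≠ 0 := by
    convert h (2 * n + 1) using 1; push_cast; ring
  have hN : (n : ℂ) + 1 ≠ 0 := by exact_mod_cast n.succ_ne_zero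
  -- As for Askey-Wilson, `A` compares leading coefficients and `B` comes from `k = 0`.
  refine ⟨(a + b + c + d + n) / (a + b + c + d + 2 * n + 1),
    -((n + 1) * (b + c + n)) / (a + b + c + d + 2 * n + 1) * ((a + b + n) * (a + c + n)),
    fun k hk => ?_⟩
  have e1 : ((n + 1 : ℕ) : ℂ) + a + b + c + d - 1 = a + b + c + d + n := by push_cast; ring
  have e2 : ((n + 1 : ℕ) : ℂ) + a + b + c + (d + 1) - 1 = a + b + c + d + n + 1 := by
    push_cast; ring
  have e3 : (n : ℂ) + a + b + c + (d + 1) - 1 = a + b + c + d + n := by ring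
  have hV : poch (a + b + c + d + n + 1) k =
      poch (a + b + c + d + n) k * (a + b + c + d + n + k) / (a + b + c + d + n) := by
    rw [eq_div_iff hS1, ← poch_succ, poch_succ', mul_comm]
  rcases hk.eq_or_lt with rfl | hk
  · rw [wilsonCoeff_eq_zero, mul_zero, add_zero, wilsonCoeff, wilsonCoeff, e1, e2, hV]
    simp only [Nat.sub_self, poch_zero]
    rw [show a + b + c + d + n + ((n + 1 : ℕ) : ℂ) = a + b + c + d + 2 * n + 1 by
      push_cast; ring]
    generalize a + b + c + d + 2 * (n : ℂ) + 1 = D at *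
    generalize a + b + c + d + (n : ℂ) = D' at *
    field_simp
  · obtain ⟨r, rfl⟩ := Nat.exists_eq_add_of_le (Nat.lt_succ_iff.1 hk)
    have e (t : ℂ) : poch (t + k) (r + 1) = poch (t + k) r * (t + ((k + r : ℕ) : ℂ)) := by
      rw [poch_succ]; push_cast; ring
    have ed : poch (a + d + k) (r + 1) = (a + d + k) * poch (a + (d + 1) + k) r := by
      rw [poch_succ']; congr 2; ring
    simp only [wilsonCoeff, e1, e2, e3]
    rw [show k + r + 1 - k = r + 1 by omega, show k + r - k = r by omega, hV,
      poch_neg_eq (k + r) k, e, e, ed, e]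
    have hQ : (k.factorial : ℂ) ≠ 0 := by exact_mod_cast k.factorial_ne_zero
    generalize poch (a + b + k) r = x1
    generalize poch (a + c + k) r = x2
    generalize poch (a + (d + 1) + k) r = x3
    generalize poch (a + b + c + d + ((k + r : ℕ) : ℂ)) k = x4
    generalize poch (-((k + r + 1 : ℕ) : ℂ)) k = x5
    generalize (k.factorial : ℂ) = x6 at hQ
    generalize ((k + r : ℕ) : ℂ) = w at *
    generalize (k : ℂ) = y at *
    clear e ed hV e1 e2 e3 h
    generalize hD1 : a + b + c + d + w = D1 at *
    generalize hD2 : a + b + c + d + 2 * w + 1 = D2 at *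
    generalize hD3 : w + 1 = D3 at *
    field_simp
    subst hD1 hD2 hD3
    ring

/-- The left side is the coefficient re-expanded in the basis for `a + 1`. The constant `B` is
literally the equation at `k = 0`, divided by the common Pochhammer symbols. -/
theorem wilsonCoeff_contiguous_base {a b c d : ℂ} (h : ∀ m : ℕ, a + b + c + d + m ≠ 0) (n : ℕ) :
    ∃ A B : ℂ, ∀ k ≤ n + 1, wilsonCoeff a b c d (n + 1) k +
        wilsonCoeff a b c d (n + 1) (k + 1) * (-((k + 1) * (2 * a + k + 1))) =
      A * wilsonCoeff (a + 1) b c d (n + 1) k + B * wilsonCoeff (a + 1) b c d n k := by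
  have hS1 : a + b + c + d + n ≠ 0 := h n
  have hS2 : a + b + c + d + 2 * n + 1 ≠ 0 := by
    convert h (2 * n + 1) using 1; push_cast; ring
  have hN : (n : ℂ) + 1 ≠ 0 := by exact_mod_cast n.succ_ne_zero
  refine ⟨(a + b + c + d + n) / (a + b + c + d + 2 * n + 1),
    (a + b) * (a + c) * (a + d) + (n + 1) * (a + b + c + d + n) * (2 * a + 1) -
      (a + b + (n + 1)) * (a + c + (n + 1)) * (a + d + (n + 1)) * (a + b + c + d + n) /
        (a + b + c + d + 2 * n + 1), fun k hk => ?_⟩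
  have e1 : ((n + 1 : ℕ) : ℂ) + a + b + c + d - 1 = a + b + c + d + n := by push_cast; ring
  have e2 : ((n + 1 : ℕ) : ℂ) + (a + 1) + b + c + d - 1 = a + b + c + d + n + 1 := by
    push_cast; ring
  have e3 : (n : ℂ) + (a + 1) + b + c + d - 1 = a + b + c + d + n := by ring
  have hV : poch (a + b + c + d + n + 1) k =
      poch (a + b + c + d + n) k * (a + b + c + d + n + k) / (a + b + c + d + n) := by
    rw [eq_div_iff hS1, ← poch_succ, poch_succ', mul_comm]
  rcases hk.eq_or_lt with rfl | hk
  · rw [wilsonCoeff_eq_zero, wilsonCoeff_eq_zero, mul_zero, zero_mul, add_zero, add_zero,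
      wilsonCoeff, wilsonCoeff, e1, e2, hV]
    simp only [Nat.sub_self, poch_zero]
    rw [show a + b + c + d + n + ((n + 1 : ℕ) : ℂ) = a + b + c + d + 2 * n + 1 by
      push_cast; ring]
    generalize a + b + c + d + 2 * (n : ℂ) + 1 = D at *
    generalize a + b + c + d + (n : ℂ) = D' at *
    field_simp
  · obtain ⟨r, rfl⟩ := Nat.exists_eq_add_of_le (Nat.lt_succ_iff.1 hk)
    have e (t : ℂ) : poch (t + k) (r + 1) = (t + k) * poch (t + (k + 1 : ℕ)) r := by
      rw [poch_succ']; push_cast; rw [add_assoc]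
    have e' (t : ℂ) : poch (a + 1 + t + k) (r + 1) =
        poch (a + t + (k + 1 : ℕ)) r * (a + t + (((k + r : ℕ) : ℂ) + 1)) := by
      rw [poch_succ, show a + 1 + t + k = a + t + (k + 1 : ℕ) by push_cast; ring]
      push_cast; ring
    have e'' (t : ℂ) : poch (a + 1 + t + k) r = poch (a + t + (k + 1 : ℕ)) r := by
      rw [show a + 1 + t + k = a + t + (k + 1 : ℕ) by push_cast; ring]
    have hk1 : (k : ℂ) + 1 ≠ 0 := by exact_mod_cast k.succ_ne_zero
    simp only [wilsonCoeff, e1, e2, e3]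
    rw [show k + r + 1 - k = r + 1 by omega, show k + r + 1 - (k + 1) = r by omega,
      show k + r - k = r by omega, hV, poch_neg_eq (k + r) k, e, e, e, e', e', e', e'', e'', e'',
      poch_succ _ k, poch_succ _ k, Nat.factorial_succ]
    have hQ : (k.factorial : ℂ) ≠ 0 := by exact_mod_cast k.factorial_ne_zero
    rw [show ((((k + 1) * k.factorial : ℕ)) : ℂ) = (k + 1) * (k.factorial : ℂ) by push_cast; ring,
      show -((k + r + 1 : ℕ) : ℂ) + k = k - ((k + r : ℕ) : ℂ) - 1 by push_cast; ring]
    generalize poch (a + b + (k + 1 : ℕ)) r = x1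
    generalize poch (a + c + (k + 1 : ℕ)) r = x2
    generalize poch (a + d + (k + 1 : ℕ)) r = x3
    generalize poch (a + b + c + d + ((k + r : ℕ) : ℂ)) k = x4
    generalize poch (-((k + r + 1 : ℕ) : ℂ)) k = x5
    generalize (k.factorial : ℂ) = x6 at hQ
    generalize ((k + r : ℕ) : ℂ) = w at *
    generalize (k : ℂ) = y at *
    clear e e' e'' hV e1 e2 e3 h
    generalize hD1 : a + b + c + d + w = D1 at *
    generalize hD2 : a + b + c + d + 2 * w + 1 = D2 at *
    generalize hD3 : w + 1 = D3 at *
    field_simp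
    subst hD1 hD2 hD3
    ring

theorem sum_wilsonBasis_shift (a : ℂ) (f : ℕ → ℂ) (n : ℕ) (hf : f (n + 1) = 0) :
    ∑ k ∈ Finset.range (n + 1), f k • wilsonBasis a k = ∑ k ∈ Finset.range (n + 1),
      (f k + f (k + 1) * (-((k + 1) * (2 * a + k + 1)))) • wilsonBasis (a + 1) k := by
  simp only [add_smul, Finset.sum_add_distrib]
  rw [Finset.sum_range_succ', Finset.sum_range_succ'
    (fun k => f k • wilsonBasis (a + 1) k), Finset.sum_range_succ
    (fun k => (f (k + 1) * _) • wilsonBasis (a + 1) k), hf, zero_mul, zero_smul, add_zero,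
    add_right_comm, ← Finset.sum_add_distrib]
  congr 1
  refine Finset.sum_congr rfl fun k _ => ?_
  rw [wilsonBasis_succ_shift, smul_add, smul_smul]

theorem wilson_mem_span_shift_d {a b c d : ℂ} (h : ∀ m : ℕ, a + b + c + d + m ≠ 0) (n : ℕ) :
    wilson a b c d n ∈ Submodule.span ℂ (wilson a b c (d + 1) '' Set.Icc (n - 1) n) := by
  refine mem_span_of_eq_combination (by rw [wilson_zero, wilson_zero]) (fun n => ?_) n
  obtain ⟨A, B, hAB⟩ := wilsonCoeff_contiguous h n
  refine ⟨A, B, ?_⟩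
  rw [wilson_eq_sum, wilson_eq_sum, wilson_eq_sum_succ _ _ _ _ n,
    Finset.smul_sum, Finset.smul_sum, ← Finset.sum_add_distrib]
  refine Finset.sum_congr rfl fun k hk => ?_
  rw [hAB k (Nat.lt_succ_iff.1 (Finset.mem_range.1 hk)), add_smul, mul_smul, mul_smul]

theorem wilson_mem_span_shift_a {a b c d : ℂ} (h : ∀ m : ℕ, a + b + c + d + m ≠ 0) (n : ℕ) :
    wilson a b c d n ∈ Submodule.span ℂ (wilson (a + 1) b c d '' Set.Icc (n - 1) n) := by
  refine mem_span_of_eq_combination (by rw [wilson_zero, wilson_zero]) (fun n => ?_) n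
  obtain ⟨A, B, hAB⟩ := wilsonCoeff_contiguous_base h n
  refine ⟨A, B, ?_⟩
  rw [wilson_eq_sum, wilson_eq_sum, wilson_eq_sum_succ _ _ _ _ n,
    sum_wilsonBasis_shift a _ _ (wilsonCoeff_eq_zero a b c d (n + 1)),
    Finset.smul_sum, Finset.smul_sum, ← Finset.sum_add_distrib]
  refine Finset.sum_congr rfl fun k hk => ?_
  rw [hAB k (Nat.lt_succ_iff.1 (Finset.mem_range.1 hk)), add_smul, mul_smul, mul_smul]

theorem wilson_mem_span_shift {a b c d : ℂ} (h : ∀ m : ℕ, a + b + c + d + m ≠ 0) (n : ℕ) :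
    wilson a b c d n ∈ Submodule.span ℂ
      (wilson (a + 1) (b + 1) (c + 1) (d + 1) '' Set.Icc (n - 4) n) := by
  have h1 := wilson_mem_span_shift_d h
  have h2 := wilson_mem_span_shift_d (a := a) (b := b) (c := d + 1) (d := c)
    (fun m => by convert h (m + 1) using 1; push_cast; ring)
  have h3 := wilson_mem_span_shift_d (a := a) (b := c + 1) (c := d + 1) (d := b)
    (fun m => by convert h (m + 2) using 1; push_cast; ring)
  have h4 := wilson_mem_span_shift_a (a := a) (b := b + 1) (c := c + 1) (d := d + 1)
    (fun m => by convert h (m + 3) using 1; push_cast; ring)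
  rw [wilson_swap_cd a b c (d + 1)] at h1
  rw [wilson_swap_bd a b (d + 1) (c + 1), wilson_swap_cd a (c + 1) (d + 1) b,
    wilson_swap_cd a (c + 1) b (d + 1)] at h2
  rw [wilson_swap_bd a (c + 1) (d + 1) (b + 1),
    wilson_swap_cd a (b + 1) (d + 1) (c + 1)] at h3
  exact mem_span_Icc_trans (mem_span_Icc_trans (mem_span_Icc_trans h1 h2) h3) h4 n

/-! ### Divided differences on the quadratic lattice. -/

section

variable {c₄ c₅ c₆ : ℂ} {hc₄ : c₄ ≠ 0}

/-- The affine substitution `x(s) ↦ -(s + c₅/(2c₄))²` on the quadratic lattice. -/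
def quadraticSubst (c₄ c₅ c₆ : ℂ) : ℂ[X] :=
  -(C c₄⁻¹ * (X - C c₆)) - C (c₅ ^ 2 / (4 * c₄ ^ 2))

theorem natDegree_quadraticSubst (hc₄ : c₄ ≠ 0) : (quadraticSubst c₄ c₅ c₆).natDegree = 1 := by
  rw [quadraticSubst, natDegree_sub_C, natDegree_neg, natDegree_affine (inv_ne_zero hc₄)]

theorem quadraticSubst_eval (hc₄ : c₄ ≠ 0) (s : ℂ) :
    (quadraticSubst c₄ c₅ c₆).eval (c₄ * s ^ 2 + c₅ * s + c₆) = -(s + c₅ / (2 * c₄)) ^ 2 := by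
  simp only [quadraticSubst, eval_sub, eval_neg, eval_mul, eval_C, eval_X]
  field_simp
  ring

/-- The divided difference on a quadratic lattice in the variable `σ = s + c₅/(2c₄)`. -/
theorem D_comp_quadratic {f g : ℂ[X]}
    (h : ∀ σ : ℂ, g.eval (-σ ^ 2) * (2 * c₄ * σ) =
      f.eval (-(σ + 1 / 2) ^ 2) - f.eval (-(σ - 1 / 2) ^ 2)) :
    (Lattice.quadratic c₄ c₅ c₆ hc₄).D (f.comp (quadraticSubst c₄ c₅ c₆)) =
      g.comp (quadraticSubst c₄ c₅ c₆) := by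
  apply Lattice.D_eq_of_isDividedDifference
  intro s
  have hh := h (s + c₅ / (2 * c₄))
  simp only [Lattice.x, eval_comp, quadraticSubst_eval hc₄]
  rw [show s + 1 / 2 + c₅ / (2 * c₄) = s + c₅ / (2 * c₄) + 1 / 2 by ring,
    show s - 1 / 2 + c₅ / (2 * c₄) = s + c₅ / (2 * c₄) - 1 / 2 by ring, ← hh]
  -- What remains is `x(s + 1/2) - x(s - 1/2) = 2 c₄ s + c₅ = 2 c₄ σ`.
  congr 1
  field_simp
  ring

/-- The values at `σ ± 1/2` share `(a + 1/2 + σ)_k (a + 1/2 - σ)_k`; the end factors differ by a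
multiple of `σ`. -/
theorem D_wilsonBasis_comp (a : ℂ) (k : ℕ) :
    (Lattice.quadratic c₄ c₅ c₆ hc₄).D
        ((wilsonBasis a (k + 1)).comp (quadraticSubst c₄ c₅ c₆)) =
      (-((k + 1) / c₄)) • (wilsonBasis (a + 1 / 2) k).comp (quadraticSubst c₄ c₅ c₆) := by
  rw [← smul_comp]
  refine D_comp_quadratic fun σ => ?_
  rw [eval_smul, wilsonBasis_eval, wilsonBasis_eval, wilsonBasis_eval, poch_succ, poch_succ',
    poch_succ', poch_succ]
  have e1 : a + (σ + 1 / 2) = a + 1 / 2 + σ := by ring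
  have e2 : a - (σ + 1 / 2) + 1 = a + 1 / 2 - σ := by ring
  have e3 : a + (σ - 1 / 2) + 1 = a + 1 / 2 + σ := by ring
  have e4 : a - (σ - 1 / 2) = a + 1 / 2 - σ := by ring
  rw [e1, e2, e3, e4, smul_eq_mul]
  field_simp
  ring

theorem D_one_comp_quadratic :
    (Lattice.quadratic c₄ c₅ c₆ hc₄).D ((1 : ℂ[X]).comp (quadraticSubst c₄ c₅ c₆)) = 0 := by
  have := D_comp_quadratic (c₄ := c₄) (c₅ := c₅) (c₆ := c₆) (hc₄ := hc₄) (f := 1) (g := 0)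
    (fun σ => by simp)
  simpa using this

theorem lowersDegree_quadratic : (Lattice.quadratic c₄ c₅ c₆ hc₄).LowersDegree := by
  have hF := natDegree_quadraticSubst (c₅ := c₅) (c₆ := c₆) hc₄
  have hc (a : ℂ) (n : ℕ) :
      ((wilsonBasis a n).comp (quadraticSubst c₄ c₅ c₆)).coeff n ≠ 0 :=
    coeff_ne_zero_of_eq_degree (degree_comp_eq hF (degree_eq_of_mem_degreeLT
      (wilsonBasis_mem_degreeLT a n) (by rw [wilsonBasis_coeff]; exact one_ne_zero)))
  refine Lattice.lowersDegree_of_basis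
    (fun n => (wilsonBasis 0 n).comp (quadraticSubst c₄ c₅ c₆))
    (fun n => comp_mem_degreeLT hF (wilsonBasis_mem_degreeLT 0 n)) (hc 0) fun n => ?_
  rw [D_wilsonBasis_comp, coeff_smul, smul_eq_mul]
  have hn : (n : ℂ) + 1 ≠ 0 := by exact_mod_cast n.succ_ne_zero
  exact mul_ne_zero (neg_ne_zero.2 (div_ne_zero hn hc₄)) (hc _ n)

theorem wilsonCoeff_succ_succ (a b c d : ℂ) (n k : ℕ) :
    wilsonCoeff a b c d (n + 1) (k + 1) * (k + 1) = -((n + 1) * (a + b + c + d + n)) *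
      wilsonCoeff (a + 1 / 2) (b + 1 / 2) (c + 1 / 2) (d + 1 / 2) n k := by
  have e (t : ℂ) : a + 1 / 2 + (t + 1 / 2) + k = a + t + (k + 1 : ℕ) := by push_cast; ring
  have hk : (k : ℂ) + 1 ≠ 0 := by exact_mod_cast k.succ_ne_zero
  have hQ : (k.factorial : ℂ) ≠ 0 := by exact_mod_cast k.factorial_ne_zero
  simp only [wilsonCoeff, e]
  rw [show n + 1 - (k + 1) = n - k by omega, poch_succ' _ k, poch_succ' _ k, Nat.factorial_succ,
    show -((n + 1 : ℕ) : ℂ) + 1 = -(n : ℂ) by push_cast; ring,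
    show ((n + 1 : ℕ) : ℂ) + a + b + c + d - 1 + 1 =
      n + (a + 1 / 2) + (b + 1 / 2) + (c + 1 / 2) + (d + 1 / 2) - 1 by push_cast; ring,
    show ((n + 1 : ℕ) : ℂ) + a + b + c + d - 1 = a + b + c + d + n by push_cast; ring]
  generalize poch _ _ = x1
  generalize poch _ _ = x2
  generalize poch _ _ = x3
  generalize poch _ _ = x4
  generalize poch _ _ = x5
  push_cast
  field_simp

theorem D_wilson_comp {a b c d : ℂ} (h : ∀ m : ℕ, a + b + c + d + m ≠ 0) (n : ℕ) :
    ∃ K : ℂ, K ≠ 0 ∧ (Lattice.quadratic c₄ c₅ c₆ hc₄).D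
        ((wilson a b c d (n + 1)).comp (quadraticSubst c₄ c₅ c₆)) =
      K • (wilson (a + 1 / 2) (b + 1 / 2) (c + 1 / 2) (d + 1 / 2) n).comp
        (quadraticSubst c₄ c₅ c₆) := by
  have hn : (n : ℂ) + 1 ≠ 0 := by exact_mod_cast n.succ_ne_zero
  refine ⟨-(c₄⁻¹) * -((n + 1) * (a + b + c + d + n)),
    mul_ne_zero (neg_ne_zero.2 (inv_ne_zero hc₄)) (neg_ne_zero.2 (mul_ne_zero hn (h n))), ?_⟩
  rw [wilson_eq_sum, wilson_eq_sum, Finset.sum_range_succ', ← compLin_apply,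
    ← compLin_apply, map_add, map_sum, map_sum, ← Lattice.DLin_apply, map_add, map_sum,
    Finset.smul_sum]
  have h0 : Lattice.DLin (.quadratic c₄ c₅ c₆ hc₄)
      (compLin (quadraticSubst c₄ c₅ c₆) (wilsonCoeff a b c d (n + 1) 0 • wilsonBasis a 0)) = 0 := by
    rw [map_smul, map_smul, show wilsonBasis a 0 = 1 by simp [wilsonBasis], compLin_apply,
      Lattice.DLin_apply, D_one_comp_quadratic, smul_zero]
  rw [h0, add_zero]
  refine Finset.sum_congr rfl fun k _ => ?_
  rw [map_smul, map_smul, map_smul, compLin_apply, compLin_apply, Lattice.DLin_apply,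
    D_wilsonBasis_comp, smul_smul, smul_smul, mul_assoc (-(c₄⁻¹)), ← wilsonCoeff_succ_succ]
  congr 1
  ring

theorem secondStructureRelation_wilson {a b c d : ℂ} (h : ∀ m : ℕ, a + b + c + d + m ≠ 0) :
    SecondStructureRelation (Lattice.quadratic c₄ c₅ c₆ hc₄)
      (fun n => (wilson a b c d n).comp (quadraticSubst c₄ c₅ c₆)) := by
  have hF := natDegree_quadraticSubst (c₅ := c₅) (c₆ := c₆) hc₄
  refine secondStructureRelation_of_banded
    (R := fun n => (wilson (a + 1) (b + 1) (c + 1) (d + 1) n).comp (quadraticSubst c₄ c₅ c₆))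
    (fun n => degree_comp_eq hF (degree_wilson h n)) (fun n => ?_) (fun n => ?_)
  · obtain ⟨K, hK, e⟩ := D_wilson_comp (c₄ := c₄) (c₅ := c₅) (c₆ := c₆) (hc₄ := hc₄) h (n + 1)
    obtain ⟨K', hK', e'⟩ := D_wilson_comp (c₄ := c₄) (c₅ := c₅) (c₆ := c₆) (hc₄ := hc₄)
      -- The four half-steps raise the parameter sum by `2`.
      (a := a + 1 / 2) (b := b + 1 / 2) (c := c + 1 / 2) (d := d + 1 / 2) (fun m => by
        convert h (m + 2) using 1
        push_cast; ring) n
    refine ⟨K * K', mul_ne_zero hK hK', ?_⟩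
    have e2 (t : ℂ) : t + 1 / 2 + 1 / 2 = t + 1 := by ring
    simp only [e2] at e'
    rw [e, ← Lattice.DLin_apply, map_smul, Lattice.DLin_apply, e', smul_smul]
  · have := Submodule.mem_map_of_mem (f := compLin (quadraticSubst c₄ c₅ c₆))
      (wilson_mem_span_shift h n)
    rwa [Submodule.map_span, ← Set.image_comp] at this

end

/-! ### Continuous dual Hahn polynomials as limits, and the Wilson class. -/

/-- The coefficient of `wilsonBasis a k` in the continuous dual Hahn polynomial of degree `n`. -/
def dualHahnCoeff (a b c : ℂ) (n k : ℕ) : ℂ :=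
  poch (a + b + k) (n - k) * poch (a + c + k) (n - k) *
    (poch (-(n : ℂ)) k / (k.factorial : ℂ))

theorem dualHahn_eq_sum (a b c : ℂ) (n : ℕ) :
    dualHahn a b c n = ∑ k ∈ Finset.range (n + 1), dualHahnCoeff a b c n k • wilsonBasis a k :=
  Finset.sum_congr rfl fun k _ => by rw [smul_eq_C_mul, dualHahnCoeff, wilsonBasis]

theorem dualHahn_mem_degreeLT (a b c : ℂ) (n : ℕ) : dualHahn a b c n ∈ degreeLT ℂ (n + 1) := by
  rw [dualHahn_eq_sum]
  exact Submodule.sum_mem _ fun k hk => Submodule.smul_mem _ _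
    (degreeLT_mono (Finset.mem_range.1 hk) (wilsonBasis_mem_degreeLT a k))

theorem degree_dualHahn (a b c : ℂ) (n : ℕ) : (dualHahn a b c n).degree = n := by
  refine degree_eq_of_mem_degreeLT (dualHahn_mem_degreeLT a b c n) ?_
  rw [dualHahn_eq_sum, coeff_sum_wilsonBasis]
  simp [dualHahnCoeff, poch_zero, poch_neg_ne_zero, Nat.factorial_ne_zero]

theorem tendsto_poch_div_pow (β : ℂ) (m : ℕ) :
    Tendsto (fun i : ℕ => poch (β + i) m / (i : ℂ) ^ m) atTop (𝓝 1) := by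
  have h (j : ℕ) : Tendsto (fun i : ℕ => (β + i + j) / (i : ℂ)) atTop (𝓝 1) := by
    have h1 : Tendsto (fun i : ℕ => (β + j) * (i : ℂ)⁻¹ + 1) atTop (𝓝 ((β + j) * 0 + 1)) :=
      ((tendsto_inv_atTop_nhds_zero_nat (𝕜 := ℂ)).const_mul _).add_const 1
    rw [mul_zero, zero_add] at h1
    refine h1.congr' ?_
    filter_upwards [eventually_ge_atTop 1] with i hi
    have : (i : ℂ) ≠ 0 := by exact_mod_cast (by omega : i ≠ 0)
    field_simp
    ring
  have h2 := tendsto_finsetProd (Finset.range m) fun j _ => h j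
  simpa [poch, Finset.prod_div_distrib] using h2

/-- The continuous dual Hahn polynomials are limits of Wilson polynomials. -/
theorem isLimitFamily_dualHahn (a b c : ℂ) :
    IsLimitFamily (fun i => wilson a b c (i + 1 - (a + b + c))) (dualHahn a b c) := by
  intro n
  -- In the `j`-th term `(a + d + j)_(n-j)` grows like `i^(n-j)` and `(n + a + b + c + d - 1)_j`
  -- like `i^j`, so one power `i^n` normalizes all terms.
  refine ⟨degree_dualHahn a b c n, fun i => ((i : ℂ) ^ n)⁻¹, fun k => ?_⟩
  simp only [wilson_eq_sum, dualHahn_eq_sum, finsetSum_coeff, coeff_smul, smul_eq_mul,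
    Finset.mul_sum, ← mul_assoc]
  refine tendsto_finsetSum _ fun j hj => Tendsto.mul_const _ ?_
  have hj' : j ≤ n := Nat.lt_succ_iff.1 (Finset.mem_range.1 hj)
  have h := ((tendsto_poch_div_pow (a + 1 - (a + b + c) + j) (n - j)).mul
    (tendsto_poch_div_pow n j)).const_mul (dualHahnCoeff a b c n j)
  rw [mul_one, mul_one] at h
  refine h.congr fun i => ?_
  rw [wilsonCoeff, dualHahnCoeff, ← Nat.sub_add_cancel hj', pow_add, Nat.sub_add_cancel hj',
    show a + (i + 1 - (a + b + c)) + j = a + 1 - (a + b + c) + j + i by ring,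
    show n + a + b + c + (i + 1 - (a + b + c)) - 1 = (n : ℂ) + i by ring, mul_inv]
  ring

/-- The fourth Wilson parameter `i + 1 - (a + b + c)` makes the parameter sum `i + 1`, so every
approximating family is admissible whatever `a, b, c` are. -/
theorem secondStructureRelation_dualHahn {c₄ c₅ c₆ : ℂ} {hc₄ : c₄ ≠ 0} (a b c : ℂ) :
    SecondStructureRelation (Lattice.quadratic c₄ c₅ c₆ hc₄)
      (fun n => (dualHahn a b c n).comp (quadraticSubst c₄ c₅ c₆)) := by
  have hF := natDegree_quadraticSubst (c₅ := c₅) (c₆ := c₆) hc₄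
  have hm (i n : ℕ) := wilson_mem_degreeLT a b c (i + 1 - (a + b + c)) n
  exact .of_isLimitFamily lowersDegree_quadratic ((isLimitFamily_dualHahn a b c).comp hm hF)
    (fun i n => comp_mem_degreeLT hF (hm i n))
    fun i => secondStructureRelation_wilson fun m => by
      have : ((i + 1 + m : ℕ) : ℂ) ≠ 0 := by exact_mod_cast (by omega)
      convert this using 1
      push_cast; ring

theorem secondStructureRelation_of_wilsonClass {c₄ c₅ c₆ : ℂ} {hc₄ : c₄ ≠ 0} {P : ℕ → ℂ[X]}
    (hP : WilsonClass P) :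
    SecondStructureRelation (Lattice.quadratic c₄ c₅ c₆ hc₄)
      (fun n => (P n).comp (quadraticSubst c₄ c₅ c₆)) := by
  have hF := natDegree_quadraticSubst (c₅ := c₅) (c₆ := c₆) hc₄
  cases hP with
  | wilson a b c d h => exact secondStructureRelation_wilson h
  | dualHahn a b c => exact secondStructureRelation_dualHahn a b c
  | wilsonLimit a b c d h _ _ _ _ _ hQ =>
    have hm (i n : ℕ) := wilson_mem_degreeLT (a i) (b i) (c i) (d i) n
    exact .of_isLimitFamily lowersDegree_quadratic (hQ.comp hm hF)
      (fun i n => comp_mem_degreeLT hF (hm i n)) fun i => secondStructureRelation_wilson (h i)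
  | dualHahnLimit a b c _ _ _ _ hQ =>
    have hm (i n : ℕ) := dualHahn_mem_degreeLT (a i) (b i) (c i) n
    exact .of_isLimitFamily lowersDegree_quadratic (hQ.comp hm hF)
      (fun i n => comp_mem_degreeLT hF (hm i n))
      fun i => secondStructureRelation_dualHahn (a i) (b i) (c i)

end StructureRelation

end

open StructureRelation in
theorem proposition4p4 :
    -- a sequence orthogonal with respect to `W` whose second divided differences are orthogonal
    -- with respect to `π W`, `deg π ≤ 4`, satisfies the second structure relation
    (∀ (L : Lattice) (a b : EReal) (W : ℝ → ℝ) (P : ℕ → ℂ[X]) (π : ℂ[X]),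
      (∀ n, (P n).degree = n) →
      IsOrthogonal a b (fun t => (W t : ℂ)) P →
      π.natDegree ≤ 4 →
      IsOrthogonal a b (fun t => π.eval (t : ℂ) * (W t : ℂ)) (fun n => L.D (L.D (P (n + 2)))) →
      SecondStructureRelation L P) ∧
    -- Askey-Wilson polynomials with special and limiting cases; on the lattice
    -- `x(s) = c₁ q^(-s) + c₂ q^s + c₃` one has `cos θ = (x - c₃) / κ`, `κ² = 4 c₁ c₂`
    (∀ (q c₁ c₂ c₃ κ : ℂ) (hq₀ : q ≠ 0) (hq₁ : q ≠ 1) (hc₁ : c₁ ≠ 0),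
      (∀ k : ℕ, 1 ≤ k → q ^ k ≠ 1) → c₂ ≠ 0 → κ ^ 2 = 4 * c₁ * c₂ →
      ∀ P : ℕ → ℂ[X], AskeyWilsonClass q P →
        SecondStructureRelation (Lattice.qQuadratic q c₁ c₂ c₃ hq₀ hq₁ hc₁)
          (fun n => (P n).comp (C κ⁻¹ * (X - C c₃)))) ∧
    -- Wilson and continuous dual Hahn polynomials with special and limiting cases; on the lattice
    -- `x(s) = c₄ s² + c₅ s + c₆` one has `-(s + c₅/(2c₄))² = -(x - c₆)/c₄ - c₅²/(4c₄²)`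
    (∀ (c₄ c₅ c₆ : ℂ) (hc₄ : c₄ ≠ 0), ∀ P : ℕ → ℂ[X], WilsonClass P →
        SecondStructureRelation (Lattice.quadratic c₄ c₅ c₆ hc₄)
          (fun n => (P n).comp (-(C c₄⁻¹ * (X - C c₆)) - C (c₅ ^ 2 / (4 * c₄ ^ 2))))) := by
  refine ⟨fun L a b W P π hP hW hπ hπW =>
      secondStructureRelation_of_isOrthogonal L a b _ P π hP hW hπ hπW,
    fun q c₁ c₂ c₃ κ hq₀ hq₁ hc₁ hq hc₂ hκ P hP =>
      secondStructureRelation_of_askeyWilsonClass hc₂ hκ hq hP,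
    fun c₄ c₅ c₆ hc₄ P hP => secondStructureRelation_of_wilsonClass hP⟩
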